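/- Let $M$ be a smooth $n$-dimensional manifold without boundary, let $\rho\in\mathbb R$, let $I\subseteq\mathbb R$ be an interval with more than one point, and let $g(t)$, $t\in I$, be a family of Riemannian metrics on $M$, smooth in space and time jointly, that solves the Ricci–Bourguignon (RB) flow $$\frac{\partial}{\partial t}g=-2\,(\mathrm{Ric}-\rho\,\mathrm R\,g).$$ (At endpoints of $I$ that belong to $I$, time derivatives are one-sided.) Here $\mathrm{Riem}(X,Y)Z=\nabla_Y\nabla_XZ-\nabla_X\nabla_YZ+\nabla_{[X,Y]}Z$ with $\nabla$ the Levi-Civita connection of $g(t)$; in local coordinates $\mathrm R_{ijk}^{l}\partial_l=\mathrm{Riem}(\partial_i,\partial_j)\partial_k$, $\mathrm R_{ijkl}=g_{lm}\mathrm R^m_{ijk}$, $\mathrm R_{ik}=g^{jl}\mathrm R_{ijkl}$, $\mathrm R=g^{ik}\mathrm R_{ik}$, $\Delta=g^{ij}\nabla_i\nabla_j$, $|\mathrm{Ric}|^2=g^{ij}g^{kl}\mathrm R_{ik}\mathrm R_{jl}$, with summation over repeated indices. Set $\mathrm B_{ijkl}=g^{pq}g^{rs}\mathrm R_{ipjr}\mathrm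 R_{kqls}$. Then, at every time $t\in I$ and in every local coordinate system of $M$, the Riemann tensor, the Ricci tensor and the scalar curvature of $g(t)$ are differentiable in time and $$\begin{aligned}\frac{\partial}{\partial t}\mathrm R_{ijkl}={}&\Delta\mathrm R_{ijkl}+2(\mathrm B_{ijkl}-\mathrm B_{ijlk}-\mathrm B_{iljk}+\mathrm B_{ikjl})\\&-g^{pq}\big(\mathrm R_{pjkl}\mathrm R_{qi}+\mathrm R_{ipkl}\mathrm R_{qj}+\mathrm R_{ijpl}\mathrm R_{qk}+\mathrm R_{ijkp}\mathrm R_{ql}\big)\\&-\rho\big(\nabla_i\nabla_k\mathrm R\,g_{jl}-\nabla_i\nabla_l\mathrm R\,g_{jk}-\nabla_j\nabla_k\mathrm R\,g_{il}+\nabla_j\nabla_l\mathrm R\,g_{ik}\big)+2\rho\,\mathrm R\,\mathrm R_{ijkl},\end{aligned}$$ $$\frac{\partial}{\partial t}\mathrm R_{ik}=\Delta\mathrm R_{ik}+2g^{pq}g^{rs}\mathrm R_{pirk}\mathrm R_{qs}-2g^{pq}\mathrm R_{pi}\mathrm R_{qk}-(n-2)\rho\,\nabla_i\nabla_k\mathrm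 R-\rho\,\Delta\mathrm R\,g_{ik},$$ $$\frac{\partial}{\partial t}\mathrm R=\big(1-2(n-1)\rho\big)\Delta\mathrm R+2|\mathrm{Ric}|^2-2\rho\,\mathrm R^2.$$ -/

import Mathlib

open Set
open scoped Manifold ContDiff Bundle

noncomputable section

namespace RBFlow

/-- The coordinate space `ℝⁿ`. -/
abbrev Coord (n : ℕ) : Type := EuclideanSpace ℝ (Fin n)

/-- Coordinate components `T_{i₁…i_r}` (functions of the coordinates) of a covariant tensor
field of rank `r`. A function is the case `r = 0`, with the only index tuple `![]`. -/
abbrev Tensor (n r : ℕ) : Type := (Fin r → Fin n) → Coord n → ℝ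

/-- The partial derivative `∂f/∂xⁱ`. -/
def pd {n : ℕ} (i : Fin n) (f : Coord n → ℝ) (y : Coord n) : ℝ :=
  fderiv ℝ f y (EuclideanSpace.single i 1)

section Coordinates

/-! Throughout this section `G y` is the matrix `(g_{ij})` of a Riemannian metric in a local
coordinate system, as a function of the coordinates `y`; thus `(G y)⁻¹ i j = g^{ij}`. -/

variable {n : ℕ} (G : Coord n → Matrix (Fin n) (Fin n) ℝ)

/-- The Christoffel symbol of the Levi-Civita connection, with upper index last:
`christoffel G i j k = Γ^k_{ij} = ½ g^{kl} (∂_i g_{jl} + ∂_j g_{il} - ∂_l g_{ij})`,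
so `∇_{∂_i} ∂_j = Γ^k_{ij} ∂_k`. -/
def christoffel (i j k : Fin n) (y : Coord n) : ℝ :=
  (1 / 2 : ℝ) * ∑ l, (G y)⁻¹ k l *
    (pd i (fun z => G z j l) y + pd j (fun z => G z i l) y - pd l (fun z => G z i j) y)

/-- The covariant derivative of a covariant tensor field; the index of differentiation is put
first: `covD G T (i, j₁, …, j_r) = ∇_i T_{j₁…j_r}
  = ∂_i T_{j₁…j_r} - ∑_a Γ^m_{i j_a} T_{j₁…m…j_r}` (with `m` in position `a`). -/
def covD {r : ℕ} (T : Tensor n r) : Tensor n (r + 1) := fun J y =>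
  pd (J 0) (T (Fin.tail J)) y -
    ∑ a : Fin r, ∑ m : Fin n,
      christoffel G (J 0) (Fin.tail J a) m y * T (Function.update (Fin.tail J) a m) y

/-- The second covariant derivative `hess G T i j J = ∇_i ∇_j T_J`. -/
def hess {r : ℕ} (T : Tensor n r) (i j : Fin n) (J : Fin r → Fin n) (y : Coord n) : ℝ :=
  covD G (covD G T) (Fin.cons i (Fin.cons j J)) y

/-- The (rough) Laplacian `Δ T_J = g^{ij} ∇_i ∇_j T_J`. -/
def laplacian {r : ℕ} (T : Tensor n r) : Tensor n r := fun J y =>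
  ∑ i, ∑ j, (G y)⁻¹ i j * hess G T i j J y

/-- The `(3,1)` curvature tensor, with upper index last: `riem31 G i j k l = R^l_{ijk}`, where
`R^l_{ijk} ∂_l = Riem(∂_i, ∂_j) ∂_k = ∇_{∂_j} ∇_{∂_i} ∂_k - ∇_{∂_i} ∇_{∂_j} ∂_k`, the convention
`Riem(X,Y)Z = ∇_Y ∇_X Z - ∇_X ∇_Y Z + ∇_{[X,Y]} Z` for coordinate fields. -/
def riem31 (i j k l : Fin n) (y : Coord n) : ℝ :=
  pd j (christoffel G i k l) y - pd i (christoffel G j k l) y +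
    ∑ m, (christoffel G i k m y * christoffel G j m l y -
      christoffel G j k m y * christoffel G i m l y)

/-- The `(4,0)` curvature tensor `R_{ijkl} = g_{lm} R^m_{ijk}` (so `R_{ijij} > 0` on round
spheres, for `i ≠ j` in orthonormal directions). -/
def riem : Tensor n 4 := fun J y =>
  ∑ m, G y (J 3) m * riem31 G (J 0) (J 1) (J 2) m y

/-- The Ricci tensor `R_{ik} = g^{jl} R_{ijkl}`. -/
def ric : Tensor n 2 := fun J y =>
  ∑ j, ∑ l, (G y)⁻¹ j l * riem G ![J 0, j, J 1, l] y

/-- The scalar curvature `R = g^{ik} R_{ik}`. -/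
def scal : Tensor n 0 := fun _ y =>
  ∑ i, ∑ k, (G y)⁻¹ i k * ric G ![i, k] y

/-- The squared norm `|Ric|² = g^{ij} g^{kl} R_{ik} R_{jl}`. -/
def ricNormSq (y : Coord n) : ℝ :=
  ∑ i, ∑ j, ∑ k, ∑ l, (G y)⁻¹ i j * (G y)⁻¹ k l * ric G ![i, k] y * ric G ![j, l] y

/-- The tensor `B_{ijkl} = g^{pq} g^{rs} R_{ipjr} R_{kqls}`. -/
def tensorB (i j k l : Fin n) (y : Coord n) : ℝ :=
  ∑ p, ∑ q, ∑ r, ∑ s, (G y)⁻¹ p q * (G y)⁻¹ r s *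
    riem G ![i, p, j, r] y * riem G ![k, q, l, s] y

end Coordinates

section Manifold

variable {n : ℕ} {M : Type*} [TopologicalSpace M] [ChartedSpace (Coord n) M]

/-- The coordinate vector field `∂/∂xⁱ` of the local coordinate system `e`, at the point with
coordinates `y`. -/
def coordVec (e : OpenPartialHomeomorph M (Coord n)) (i : Fin n) (y : Coord n) :
    TangentSpace (𝓡 n) (e.symm y) :=
  mfderiv 𝓘(ℝ, Coord n) (𝓡 n) e.symm y (EuclideanSpace.single i (1 : ℝ) : Coord n)

variable [IsManifold (𝓡 n) ∞ M]

variable (M) in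
/-- Smooth Riemannian metrics on the `n`-dimensional smooth manifold `M`. -/
abbrev Metric : Type _ :=
  Bundle.ContMDiffRiemannianMetric (𝓡 n) ∞ (Coord n) (fun x : M => TangentSpace (𝓡 n) x)

/-- The matrix `g_{ij} = g(∂/∂xⁱ, ∂/∂xʲ)` of the metric `g` in the local coordinate system `e`,
as a function of the coordinates. -/
def metricCoord (g : Metric (n := n) M) (e : OpenPartialHomeomorph M (Coord n)) (y : Coord n) :
    Matrix (Fin n) (Fin n) ℝ :=
  Matrix.of fun i j => g.inner (e.symm y) (coordVec e i y) (coordVec e j y)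

/-- `g(t)`, `t ∈ I`, is a smooth solution on `M` of the Ricci-Bourguignon flow
`∂g/∂t = -2 (Ric - ρ R g)`: in every local coordinate system of `M` the components `g_{ij}` are
smooth functions of time and coordinates jointly, and satisfy
`∂g_{ij}/∂t = -2 (R_{ij} - ρ R g_{ij})` (one-sided derivatives at endpoints of `I`). -/
structure IsRBFlow (ρ : ℝ) (I : Set ℝ) (g : ℝ → Metric (n := n) M) : Prop where
  smooth : ∀ e ∈ IsManifold.maximalAtlas (𝓡 n) ∞ M, ∀ i j : Fin n,
    ContDiffOn ℝ ∞ (fun p : ℝ × Coord n => metricCoord (g p.1) e p.2 i j) (I ×ˢ e.target)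
  evolution : ∀ e ∈ IsManifold.maximalAtlas (𝓡 n) ∞ M, ∀ t ∈ I, ∀ y ∈ e.target, ∀ i j : Fin n,
    HasDerivWithinAt (fun s => metricCoord (g s) e y i j)
      (-2 * (ric (metricCoord (g t) e) ![i, j] y -
        ρ * scal (metricCoord (g t) e) ![] y * metricCoord (g t) e y i j)) I t

end Manifold

end RBFlow

end

/-! In a chart the statement is an algebraic identity. Smooth functions on `I ×ˢ e.target` form a
commutative real algebra, on which the coordinate derivatives are commuting derivations and `∂/∂t`
is one more derivation `D` commuting with them. Curvature, Hessians and Laplacians need only the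
metric, its inverse and these derivations, so the computation is carried out over an arbitrary such
algebra (`FormalMetric`) and then evaluated at a point.

The algebra has three ingredients. The first variation (`two_mul_derivation_rm`) expresses `2 D
R_{ijkl}`, for `D g = h`, by `Rm * h` terms and second covariant derivatives of `h`. Here `h = -2
Ric + 2ρ R g`. Since `∇g = 0`, the part `2ρ R g` contributes only Hessians of `R` times `g` and a
multiple of `R Rm`. The part `-2 Ric` contributes Hessians of `Ric`, which Hamilton's formula
(`lap_rm`) turns into `Δ Rm` plus quadratic terms; that formula comes from the second Bianchi
identity, used once differentiated and once contracted, with a commutation of derivatives in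
between. Finally, the Ricci and scalar equations are traces of the Riemann equation, corrected by
the variation of `g^{ij}` (`derivation_tr`).

The return to analysis needs two facts: the metric matrix is invertible over the algebra, and mixed
derivatives commute up to the endpoints of `I`. -/

noncomputable section

namespace RBFlow

/-! ### Metrics over an algebra with commuting derivations -/

/-- The components `g_{ij}` of a metric, and their inverse `g^{ij}`, with values in a commutative
algebra `A` with commuting derivations `∂_1, …, ∂_n`. -/
structure FormalMetric (n : ℕ) (A : Type*) [CommRing A] [Algebra ℝ A] where
  /-- the coordinate derivations -/
  d : Fin n → Derivation ℝ A A
  /-- the metric -/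
  g : Fin n → Fin n → A
  /-- the inverse metric -/
  gu : Fin n → Fin n → A
  d_comm : ∀ i j a, d i (d j a) = d j (d i a)
  g_symm : ∀ i j, g i j = g j i
  gu_symm : ∀ i j, gu i j = gu j i
  gu_mul_g : ∀ i j, ∑ m, gu i m * g m j = if i = j then 1 else 0

namespace FormalMetric

variable {n : ℕ} {A : Type*} [CommRing A] [Algebra ℝ A] (S : FormalMetric n A)

/-- The formal Christoffel symbol `Γ^k_{ij}`. -/
def chr (i j k : Fin n) : A :=
  (1 / 2 : ℝ) • ∑ l, S.gu k l * (S.d i (S.g j l) + S.d j (S.g i l) - S.d l (S.g i j))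

/-- The formal curvature `R^l_{ijk}`. -/
def rm31 (i j k l : Fin n) : A :=
  S.d j (S.chr i k l) - S.d i (S.chr j k l) +
    ∑ m, (S.chr i k m * S.chr j m l - S.chr j k m * S.chr i m l)

/-- The formal curvature `R_{ijkl}`. -/
def rm (i j k l : Fin n) : A := ∑ m, S.g l m * S.rm31 i j k m

lemma chr_symm (i j k : Fin n) : S.chr i j k = S.chr j i k := by
  simp only [chr, S.g_symm i j, add_comm (S.d i _)]

lemma g_mul_gu (i j : Fin n) : ∑ m, S.g i m * S.gu m j = if i = j then 1 else 0 := by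
  have := S.gu_mul_g j i
  simp only [eq_comm (a := j)] at this
  rw [← this]
  exact Finset.sum_congr rfl fun m _ => by rw [S.g_symm, S.gu_symm, mul_comm]

/-! ### Contraction with the inverse metric -/

section Contraction

variable {X : Type*} [AddCommGroup X] [Module A X]

/-- The contraction `g^{pq} T_{pq}`. -/
def tr (T : Fin n → Fin n → X) : X := ∑ p, ∑ q, S.gu p q • T p q

lemma tr_add (T U : Fin n → Fin n → X) : S.tr (fun p q => T p q + U p q) = S.tr T + S.tr U := by
  simp only [tr, smul_add, Finset.sum_add_distrib]

lemma tr_neg (T : Fin n → Fin n → X) : S.tr (fun p q => -T p q) = -S.tr T := by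
  simp only [tr, smul_neg, Finset.sum_neg_distrib]

lemma tr_sub (T U : Fin n → Fin n → X) : S.tr (fun p q => T p q - U p q) = S.tr T - S.tr U := by
  simp only [tr, smul_sub, Finset.sum_sub_distrib]

lemma tr_smul (a : A) (T : Fin n → Fin n → X) : S.tr (fun p q => a • T p q) = a • S.tr T := by
  simp only [tr, Finset.smul_sum, smul_comm a]

lemma tr_mul_left (a : A) (T : Fin n → Fin n → A) : S.tr (fun p q => a * T p q) = a * S.tr T :=
  S.tr_smul a T

lemma tr_mul_right (a : A) (T : Fin n → Fin n → A) : S.tr (fun p q => T p q * a) = S.tr T * a := by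
  simp only [mul_comm _ a, tr_mul_left]

lemma tr_flip (T : Fin n → Fin n → X) : S.tr (fun p q => T q p) = S.tr T := by
  rw [tr, Finset.sum_comm]
  simp only [tr, S.gu_symm]

lemma tr_sum {ι : Type*} (s : Finset ι) (T : ι → Fin n → Fin n → X) :
    S.tr (fun p q => ∑ m ∈ s, T m p q) = ∑ m ∈ s, S.tr (T m) := by
  simp only [tr, Finset.smul_sum]
  exact (Finset.sum_congr rfl fun p _ => Finset.sum_comm).trans Finset.sum_comm

lemma tr_tr_comm (T : Fin n → Fin n → Fin n → Fin n → X) :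
    S.tr (fun p q => S.tr (fun r s => T p q r s)) =
      S.tr (fun r s => S.tr (fun p q => T p q r s)) := by
  conv_rhs => unfold tr
  conv_lhs => enter [2, p, q]; unfold tr
  simp only [tr_sum, tr_smul]
  rfl

lemma tr_apply {Y : Type*} (T : Fin n → Fin n → Y → X) (y : Y) :
    S.tr T y = S.tr fun p q => T p q y := by
  simp only [tr, Finset.sum_apply, Pi.smul_apply]

lemma tr_mul_g (T : Fin n → A) (i : Fin n) : S.tr (fun p q => T p * S.g q i) = T i := by
  simp only [tr, smul_eq_mul, mul_left_comm _ (T _), ← Finset.mul_sum, S.gu_mul_g]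
  simp

lemma tr_mul_g' (T : Fin n → A) (i : Fin n) : S.tr (fun p q => T p * S.g i q) = T i := by
  simp only [S.g_symm i, tr_mul_g]

lemma tr_g_mul (T : Fin n → A) (i : Fin n) : S.tr (fun p q => S.g p i * T q) = T i := by
  rw [← S.tr_flip]
  simp only [mul_comm _ (T _), tr_mul_g]

lemma tr_g : S.tr S.g = n := by
  simp only [tr, smul_eq_mul]
  have (p : Fin n) : ∑ q, S.gu p q * S.g p q = 1 := by
    rw [← if_pos (rfl : p = p) (t := (1 : A)) (e := 0), ← S.gu_mul_g p p]
    exact Finset.sum_congr rfl fun q _ => by rw [S.g_symm]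
  simp [this]

/-- Differentiate `g⁻¹ g = 1` and multiply by `g⁻¹` on the right. An arbitrary derivation is
allowed, so that both `∂_i` and the time derivative are covered. -/
lemma derivation_gu (D : Derivation ℝ A A) (i j : Fin n) :
    D (S.gu i j) = -∑ a, ∑ b, S.gu i a * D (S.g a b) * S.gu b j := by
  have h (b : Fin n) : ∑ a, S.gu i a * D (S.g a b) = -∑ a, D (S.gu i a) * S.g a b := by
    have := congrArg D (S.gu_mul_g i b)
    rw [map_sum, apply_ite D] at this
    simp only [Derivation.leibniz, smul_eq_mul, map_zero, Derivation.map_one_eq_zero, ite_self,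
      Finset.sum_add_distrib] at this
    rw [eq_neg_iff_add_eq_zero, ← this]
    simp only [mul_comm]
  rw [Finset.sum_comm]
  simp only [← Finset.sum_mul, h]
  simp only [neg_mul, Finset.sum_neg_distrib, neg_neg, Finset.sum_mul]
  rw [Finset.sum_comm]
  simp only [mul_assoc, ← Finset.mul_sum, S.g_mul_gu]
  simp

end Contraction

/-! ### The Levi-Civita connection on tensors of every rank -/

lemma sum_g_mul_chr (i j k : Fin n) : ∑ l, S.g k l * S.chr i j l =
    (1 / 2 : ℝ) • (S.d i (S.g j k) + S.d j (S.g i k) - S.d k (S.g i j)) := by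
  simp only [chr, mul_smul_comm, ← Finset.smul_sum, Finset.mul_sum, ← mul_assoc]
  rw [Finset.sum_comm]
  simp only [← Finset.sum_mul, S.g_mul_gu]
  simp

/-- This is `∇g = 0`: in the sum of the two Koszul expressions everything but `∂_i g_{jk}` cancels.
-/
lemma d_g (i j k : Fin n) : S.d i (S.g j k) =
    ∑ m, S.chr i j m * S.g m k + ∑ m, S.chr i k m * S.g j m := by
  have h1 := S.sum_g_mul_chr i j k
  have h2 := S.sum_g_mul_chr i k j
  have e1 : ∑ m, S.chr i j m * S.g m k = ∑ m, S.g k m * S.chr i j m :=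
    Finset.sum_congr rfl fun m _ => by rw [mul_comm, S.g_symm]
  have e2 : ∑ m, S.chr i k m * S.g j m = ∑ m, S.g j m * S.chr i k m :=
    Finset.sum_congr rfl fun m _ => by rw [mul_comm]
  rw [e1, e2, h1, h2, S.g_symm k j, ← smul_add]
  rw [show S.d i (S.g j k) + S.d j (S.g i k) - S.d k (S.g i j) +
    (S.d i (S.g j k) + S.d k (S.g i j) - S.d j (S.g i k)) = (2 : ℝ) • S.d i (S.g j k) by
      rw [two_smul]; ring, smul_smul]
  norm_num

lemma d_gu (i p q : Fin n) : S.d i (S.gu p q) =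
    -∑ m, S.gu p m * S.chr i m q - ∑ m, S.chr i m p * S.gu m q := by
  have h1 : ∑ a, ∑ b, S.gu p a * (∑ m, S.chr i a m * S.g m b) * S.gu b q =
      ∑ m, S.gu p m * S.chr i m q := by
    refine Finset.sum_congr rfl fun a _ => ?_
    simp only [Finset.mul_sum, Finset.sum_mul]
    rw [Finset.sum_comm]
    simp only [mul_assoc, ← Finset.mul_sum, S.g_mul_gu]
    simp
  have h2 : ∑ a, ∑ b, S.gu p a * (∑ m, S.chr i b m * S.g a m) * S.gu b q =
      ∑ m, S.chr i m p * S.gu m q := by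
    rw [Finset.sum_comm]
    refine Finset.sum_congr rfl fun b _ => ?_
    rw [← Finset.sum_mul]
    congr 1
    simp only [Finset.mul_sum]
    rw [Finset.sum_comm]
    simp only [mul_left_comm _ (S.chr _ _ _), ← Finset.mul_sum, S.gu_mul_g]
    simp
  rw [derivation_gu]
  simp only [d_g, mul_add, add_mul, Finset.sum_add_distrib, h1, h2]
  ring

/-- An operator `∇_i` on the `A`-module `X` satisfying the Leibniz rule. -/
structure Conn (X : Type*) [AddCommGroup X] [Module A X] where
  /-- the covariant derivative -/
  nab : Fin n → X →+ X
  leibniz : ∀ i (a : A) (x : X), nab i (a • x) = S.d i a • x + a • nab i x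

variable {S} in
/-- The connection on `X`-valued covectors: `(∇_i T)_j = ∇_i (T_j) - Γ^m_{ij} T_m`. -/
def Conn.ext {X : Type*} [AddCommGroup X] [Module A X] (N : S.Conn X) : S.Conn (Fin n → X) where
  nab i :=
    { toFun := fun T j => N.nab i (T j) - ∑ m, S.chr i j m • T m
      map_zero' := by ext j; simp
      map_add' := fun T U => by
        ext j
        simp only [Pi.add_apply, map_add, smul_add, Finset.sum_add_distrib]
        abel }
  leibniz i a T := by
    ext j
    simp only [AddMonoidHom.coe_mk, ZeroHom.coe_mk, Pi.smul_apply, Pi.add_apply, N.leibniz,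
      smul_sub, Finset.smul_sum, smul_comm a]
    abel

/-- The derivations as a connection on functions. -/
def conn0 : S.Conn A where
  nab i := (S.d i : A →ₗ[ℝ] A).toAddMonoidHom
  leibniz i a x := by simp [mul_comm]; ring

/-- The Levi-Civita connection on covectors. -/
abbrev conn1 : S.Conn (Fin n → A) := S.conn0.ext
/-- The Levi-Civita connection on covariant tensors of rank 2. -/
abbrev conn2 : S.Conn (Fin n → Fin n → A) := S.conn1.ext
/-- The Levi-Civita connection on covariant tensors of rank 3. -/
abbrev conn3 : S.Conn (Fin n → Fin n → Fin n → A) := S.conn2.ext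
/-- The Levi-Civita connection on covariant tensors of rank 4. -/
abbrev conn4 : S.Conn (Fin n → Fin n → Fin n → Fin n → A) := S.conn3.ext
/-- The Levi-Civita connection on covariant tensors of rank 5. -/
abbrev conn5 : S.Conn (Fin n → Fin n → Fin n → Fin n → Fin n → A) := S.conn4.ext

@[simp] lemma conn0_nab (i : Fin n) (a : A) : S.conn0.nab i a = S.d i a := rfl

namespace Conn

variable {S}
variable {X : Type*} [AddCommGroup X] [Module A X] (N : S.Conn X)

lemma ext_nab (i j : Fin n) (T : Fin n → X) :
    N.ext.nab i T j = N.nab i (T j) - ∑ m, S.chr i j m • T m := rfl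

/-- The second covariant derivative `∇_i ∇_j x`. -/
def hess (i j : Fin n) (x : X) : X := N.nab i (N.nab j x) - ∑ m, S.chr i j m • N.nab m x

/-- Seen as a first derivative one rank higher, the Hessian allows an identity between the tensors
`∇_j x` to be differentiated again. -/
lemma hess_eq (i j : Fin n) (x : X) : N.hess i j x = N.ext.nab i (fun j => N.nab j x) j := rfl

/-- The rough Laplacian. -/
def lap (x : X) : X := S.tr fun i j => N.hess i j x

lemma hess_sub_hess (i j : Fin n) (x : X) :
    N.hess i j x - N.hess j i x = N.nab i (N.nab j x) - N.nab j (N.nab i x) := by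
  simp only [hess, S.chr_symm j i]
  abel

/-- One inductive step of the Ricci identity: each added covariant index contributes one curvature
term. The cross terms `Γ ∇T` are symmetric in the two directions and cancel; what remains is the
coordinate expression of the curvature. -/
lemma hess_ext_comm (i j k : Fin n) (T : Fin n → X) :
    N.ext.hess i j T k - N.ext.hess j i T k =
      N.hess i j (T k) - N.hess j i (T k) + ∑ l, S.rm31 i j k l • T l := by
  have key (a b : Fin n) : N.ext.nab a (N.ext.nab b T) k = N.nab a (N.nab b (T k))
      - ∑ m, S.chr b k m • N.nab a (T m) - ∑ m, S.chr a k m • N.nab b (T m)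
      - ∑ m, S.d a (S.chr b k m) • T m + ∑ l, (∑ m, S.chr a k m * S.chr b m l) • T l := by
    simp only [ext_nab, map_sub, map_sum, N.leibniz, Finset.sum_add_distrib, smul_sub,
      Finset.sum_sub_distrib, Finset.smul_sum, Finset.sum_smul, smul_smul]
    rw [Finset.sum_comm (f := fun x y => (S.chr a k x * S.chr b x y) • T y)]
    abel
  have h := congrFun (N.ext.hess_sub_hess i j T) k
  rw [Pi.sub_apply, Pi.sub_apply] at h
  rw [h, N.hess_sub_hess, key, key]
  simp only [rm31, add_smul, sub_smul, Finset.sum_sub_distrib, Finset.sum_add_distrib]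
  abel

/-- Contraction commutes with `∇` because `g^{pq}` is parallel, which is the content of `d_gu`. -/
lemma nab_tr (i : Fin n) (T : Fin n → Fin n → X) :
    N.nab i (S.tr T) = S.tr (N.ext.ext.nab i T) := by
  have e1 : ∑ p, ∑ q, (∑ m, S.gu p m * S.chr i m q) • T p q =
      ∑ p, ∑ q, S.gu p q • ∑ m, S.chr i q m • T p m := by
    refine Finset.sum_congr rfl fun p _ => ?_
    simp only [Finset.sum_smul, Finset.smul_sum, smul_smul]
    rw [Finset.sum_comm]
  have e2 : ∑ p, ∑ q, (∑ m, S.chr i m p * S.gu m q) • T p q =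
      ∑ p, ∑ q, S.gu p q • ∑ m, S.chr i p m • T m q := by
    rw [Finset.sum_comm, Finset.sum_comm (s := Finset.univ)
      (f := fun p q => S.gu p q • ∑ m, S.chr i p m • T m q)]
    refine Finset.sum_congr rfl fun p _ => ?_
    simp only [Finset.sum_smul, Finset.smul_sum, smul_smul]
    rw [Finset.sum_comm]
    simp only [mul_comm]
  simp only [tr, map_sum, N.leibniz, S.d_gu, sub_smul, neg_smul, Finset.sum_add_distrib,
    Finset.sum_sub_distrib, Finset.sum_neg_distrib, e1, e2, ext_nab, Pi.sub_apply, smul_sub,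
    Finset.sum_apply, Pi.smul_apply]
  abel

lemma hess_tr (i j : Fin n) (T : Fin n → Fin n → X) :
    N.hess i j (S.tr T) = S.tr (N.ext.ext.hess i j T) := by
  simp only [hess, nab_tr]
  simp only [tr, Pi.sub_apply, Finset.sum_apply, Pi.smul_apply, smul_sub, Finset.sum_sub_distrib]
  congr 1
  simp only [Finset.smul_sum, smul_comm (S.chr _ _ _)]
  rw [Finset.sum_comm]
  exact Finset.sum_congr rfl fun p _ => Finset.sum_comm

lemma lap_tr (T : Fin n → Fin n → X) : N.lap (S.tr T) = S.tr (N.ext.ext.lap T) := by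
  have (p q : Fin n) : N.ext.ext.lap T p q = S.tr fun i j => N.ext.ext.hess i j T p q := by
    simp only [lap, tr_apply]
  rw [show S.tr (N.ext.ext.lap T) = S.tr fun p q => N.ext.ext.lap T p q from rfl]
  simp only [this]
  rw [tr_tr_comm]
  simp only [lap, hess_tr]

end Conn

/-! ### Ricci identities and the algebraic symmetries of curvature -/

section Symmetries

lemma sum_rm31_smul {X : Type*} [AddCommGroup X] [Module A X] (i j k : Fin n) (T : Fin n → X) :
    ∑ l, S.rm31 i j k l • T l = S.tr fun p q => S.rm i j k p • T q := by
  simp only [tr, rm, Finset.sum_smul, Finset.smul_sum, smul_smul]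
  rw [Finset.sum_comm]
  have (q m : Fin n) : ∑ p, (S.gu p q * (S.g p m * S.rm31 i j k m)) • T q =
      (if q = m then 1 else 0 : A) • S.rm31 i j k m • T q := by
    rw [← S.gu_mul_g, Finset.sum_smul]
    exact Finset.sum_congr rfl fun p _ => by rw [S.gu_symm, smul_smul, mul_assoc]
  refine Finset.sum_congr rfl fun q _ => ?_
  rw [Finset.sum_comm]
  simp [this]

lemma hess_ext_sub {X : Type*} [AddCommGroup X] [Module A X] (N : S.Conn X)
    (i j k : Fin n) (T : Fin n → X) :
    N.ext.hess i j T k - N.ext.hess j i T k =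
      N.hess i j (T k) - N.hess j i (T k) + S.tr fun p q => S.rm i j k p • T q := by
  rw [N.hess_ext_comm, sum_rm31_smul]

lemma hess_conn0_symm (i j : Fin n) (a : A) : S.conn0.hess i j a = S.conn0.hess j i a := by
  rw [← sub_eq_zero, S.conn0.hess_sub_hess]
  simp [S.d_comm i j]

lemma hess_conn1_sub (i j k : Fin n) (T : Fin n → A) :
    S.conn1.hess i j T k - S.conn1.hess j i T k = S.tr fun p q => S.rm i j k p * T q := by
  rw [hess_ext_sub, S.hess_conn0_symm i j, sub_self, zero_add]
  rfl

lemma hess_conn2_sub (i j k l : Fin n) (T : Fin n → Fin n → A) :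
    S.conn2.hess i j T k l - S.conn2.hess j i T k l =
      S.tr (fun p q => S.rm i j k p * T q l) + S.tr fun p q => S.rm i j l p * T k q := by
  have h := congrFun (S.hess_ext_sub S.conn1 i j k T) l
  simp only [Pi.sub_apply, Pi.add_apply, tr_apply, Pi.smul_apply, smul_eq_mul] at h
  rw [h, hess_conn1_sub, add_comm]

lemma hess_conn3_sub (i j k l m : Fin n) (T : Fin n → Fin n → Fin n → A) :
    S.conn3.hess i j T k l m - S.conn3.hess j i T k l m =
      S.tr (fun p q => S.rm i j k p * T q l m) + S.tr (fun p q => S.rm i j l p * T k q m) +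
        S.tr fun p q => S.rm i j m p * T k l q := by
  have h := congrFun (congrFun (S.hess_ext_sub S.conn2 i j k T) l) m
  simp only [Pi.sub_apply, Pi.add_apply, tr_apply, Pi.smul_apply, smul_eq_mul] at h
  rw [h, hess_conn2_sub]
  abel

lemma hess_conn4_sub (i j k l m o : Fin n) (T : Fin n → Fin n → Fin n → Fin n → A) :
    S.conn4.hess i j T k l m o - S.conn4.hess j i T k l m o =
      S.tr (fun p q => S.rm i j k p * T q l m o) + S.tr (fun p q => S.rm i j l p * T k q m o) +
        S.tr (fun p q => S.rm i j m p * T k l q o) + S.tr fun p q => S.rm i j o p * T k l m q := by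
  have h := congrFun (congrFun (congrFun (S.hess_ext_sub S.conn3 i j k T) l) m) o
  simp only [Pi.sub_apply, Pi.add_apply, tr_apply, Pi.smul_apply, smul_eq_mul] at h
  rw [h, hess_conn3_sub]
  abel

lemma nab_g (i : Fin n) : S.conn2.nab i S.g = 0 := by
  ext j k
  simp only [Conn.ext_nab, Pi.sub_apply, Finset.sum_apply, Pi.smul_apply, smul_eq_mul, conn0_nab,
    S.d_g i j k, Pi.zero_apply]
  ring

lemma rm_swap12 (i j k l : Fin n) : S.rm j i k l = -S.rm i j k l := by
  simp only [rm, ← Finset.sum_neg_distrib, ← mul_neg]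
  refine Finset.sum_congr rfl fun m _ => ?_
  simp only [rm31, Finset.sum_sub_distrib]
  ring

/-- The Ricci identity for the tensor `g`: both Hessians vanish because `∇g = 0`, and the two
curvature terms left are `R_{ijkl} + R_{ijlk}`. -/
lemma rm_swap34 (i j k l : Fin n) : S.rm i j l k = -S.rm i j k l := by
  have h := S.hess_conn2_sub i j k l S.g
  simp only [Conn.hess, nab_g, map_zero, smul_zero, Finset.sum_const_zero, sub_self,
    Pi.zero_apply, tr_mul_g, tr_mul_g'] at h
  rw [eq_neg_iff_add_eq_zero, add_comm, ← h]

lemma rm_cyc (i j k l : Fin n) : S.rm i j k l + S.rm j k i l + S.rm k i j l = 0 := by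
  simp only [rm, ← Finset.sum_add_distrib, ← mul_add]
  refine Finset.sum_eq_zero fun m _ => ?_
  simp only [rm31, Finset.sum_sub_distrib, S.chr_symm j i, S.chr_symm k i, S.chr_symm k j]
  ring

lemma two_mul_cancel {a b : A} (h : 2 * a = 2 * b) : a = b := by
  have h2 : (1 / 2 : ℝ) • (2 * a) = (1 / 2 : ℝ) • (2 * b) := by rw [h]
  have (c : A) : (1 / 2 : ℝ) • (2 * c) = c := by
    rw [two_mul, ← two_smul ℝ c, smul_smul]; norm_num
  rwa [this, this] at h2

/-- The octahedron argument: four instances of the first Bianchi identity combine, through the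
antisymmetries, to twice the claim. -/
lemma rm_pair (i j k l : Fin n) : S.rm k l i j = S.rm i j k l := by
  have h1 := S.rm_cyc i j k l
  have h2 := S.rm_cyc j k l i
  have h3 := S.rm_cyc k l i j
  have h4 := S.rm_cyc l i j k
  rw [S.rm_swap34 j k i l, S.rm_swap34 k l i j, S.rm_swap12 j l k i] at h2
  rw [S.rm_swap34 l i j k, S.rm_swap12 i l j k, S.rm_swap12 k i l j, S.rm_swap34 k i j l] at h3
  rw [S.rm_swap12 i l j k, S.rm_swap34 i j k l, S.rm_swap34 j l k i] at h4
  apply two_mul_cancel (A := A)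
  linear_combination -h1 - h2 + h3 + h4

end Symmetries

/-! ### The second Bianchi identity and its contraction -/

section Bianchi

variable {S}

lemma tr_congr {X : Type*} [AddCommGroup X] [Module A X] {T U : Fin n → Fin n → X}
    (h : ∀ p q, T p q = U p q) : S.tr T = S.tr U := by
  rw [show T = U from funext fun p => funext fun q => h p q]

variable (S)

/-- A symmetry of a tensor passes to its covariant derivative because `∇` commutes with permutations
of the slots. -/
lemma nab_rm_swap12 (p i j k l : Fin n) :
    S.conn4.nab p S.rm j i k l = -S.conn4.nab p S.rm i j k l := by
  have h : S.rm = -fun i j k l => S.rm j i k l := by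
    ext i j k l; simp [S.rm_swap12 i j k l]
  conv_lhs => rw [h, map_neg]
  simp only [Conn.ext_nab, Pi.neg_apply, Pi.sub_apply, Finset.sum_apply, Pi.smul_apply,
    smul_eq_mul, conn0_nab]
  ring

lemma nab_rm_pair (p i j k l : Fin n) :
    S.conn4.nab p S.rm k l i j = S.conn4.nab p S.rm i j k l := by
  have h : S.rm = fun i j k l => S.rm k l i j := by
    ext i j k l; simp [S.rm_pair i j k l]
  conv_lhs => rw [h]
  simp only [Conn.ext_nab, Pi.sub_apply, Finset.sum_apply, Pi.smul_apply,
    smul_eq_mul, conn0_nab]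
  ring

lemma nab_tr_rm_mul (m i j k : Fin n) (w : Fin n → A) :
    S.conn3.nab m (fun i j k => S.tr fun p q => S.rm i j k p * w q) i j k =
      S.tr (fun p q => S.conn4.nab m S.rm i j k p * w q) +
        S.tr fun p q => S.rm i j k p * S.conn1.nab m w q := by
  have h : (fun i j k => S.tr fun p q => S.rm i j k p * w q) =
      S.tr fun p q i j k => S.rm i j k p * w q := by
    ext i j k
    simp only [tr_apply]
  rw [h, Conn.nab_tr, ← tr_add]
  simp only [tr_apply]
  refine tr_congr fun p q => ?_
  simp only [Conn.ext_nab, Pi.sub_apply, Finset.sum_apply, Pi.smul_apply,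
    smul_eq_mul, conn0_nab, Derivation.leibniz, sub_mul, mul_sub, Finset.sum_mul, Finset.mul_sum]
  simp only [mul_assoc, mul_left_comm, mul_comm]
  ring

/-- The cyclic sum over `m, i, j` of the third derivatives of a covector `w`, antisymmetrised, is
computed in two ways. Commuting the inner pair and then differentiating gives `∇Rm * w + Rm * ∇w`;
commuting the outer pair gives `Rm * ∇w` only. Comparison leaves the cyclic sum of `∇Rm` contracted
with `w`. -/
lemma nab_rm_cyc (m i j k l : Fin n) :
    S.conn4.nab m S.rm i j k l + S.conn4.nab i S.rm j m k l + S.conn4.nab j S.rm m i k l = 0 := by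
  -- With `l` frozen, `w` is a covector whose contraction with `Rm` returns the component
  -- `R_{ijkl}`. It is not parallel, since `∇` does not act on `l`.
  set w : Fin n → A := fun q => S.g q l with hw
  set H : Fin n → Fin n → Fin n → A := fun i j => S.conn1.hess i j w with hH
  have hF (m i j : Fin n) :
      S.conn3.nab m H i j k - S.conn3.nab m H j i k = S.conn4.nab m S.rm i j k l +
        S.tr fun p q => S.rm i j k p * S.conn1.nab m w q := by
    have h1 : (fun i j k => S.tr fun p q => S.rm i j k p * w q) =
        H - fun i j k => H j i k := by
      ext i j k
      simp only [← hess_conn1_sub, Pi.sub_apply, hH]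
    have h2 := S.nab_tr_rm_mul m i j k w
    rw [h1, map_sub, tr_mul_g] at h2
    rw [← h2]
    simp only [Conn.ext_nab, Pi.sub_apply, Finset.sum_apply, Pi.smul_apply,
      smul_eq_mul, conn0_nab]
    ring
  have hC (m i j : Fin n) : S.conn3.nab m H i j k - S.conn3.nab i H m j k =
      S.tr (fun p q => S.rm m i j p * S.conn1.nab q w k) +
        S.tr fun p q => S.rm m i k p * S.conn1.nab j w q :=
    S.hess_conn2_sub m i j k fun j => S.conn1.nab j w
  -- The outer commutators also act on the index of the inner derivative; these terms cancel by the
  -- first Bianchi identity.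
  have h0 : S.tr (fun p q => S.rm m i j p * S.conn1.nab q w k) +
      S.tr (fun p q => S.rm i j m p * S.conn1.nab q w k) +
      S.tr (fun p q => S.rm j m i p * S.conn1.nab q w k) = 0 := by
    simp only [← tr_add, ← add_mul, rm_cyc, zero_mul]
    simp [tr]
  linear_combination h0 - hF m i j - hF i j m - hF j m i + hC m i j + hC i j m + hC j m i

/-- The formal Ricci tensor. -/
def rc (i k : Fin n) : A := S.tr fun j l => S.rm i j k l

/-- The formal scalar curvature. -/
def sc : A := S.tr S.rc

lemma rc_symm (i k : Fin n) : S.rc i k = S.rc k i := by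
  rw [rc, rc, ← tr_flip]
  exact tr_congr fun p q => S.rm_pair _ _ _ _

/-- Reduces to `nab_tr`, which contracts the two leading slots, by moving slots 2 and 4 to the
front. -/
lemma nab_tr24 (p i k : Fin n) (T : Fin n → Fin n → Fin n → Fin n → A) :
    S.conn2.nab p (fun i k => S.tr fun j l => T i j k l) i k =
      S.tr fun j l => S.conn4.nab p T i j k l := by
  have h : (fun i k => S.tr fun j l => T i j k l) = S.tr fun j l i k => T i j k l := by
    ext i k
    simp only [tr_apply]
  rw [h, Conn.nab_tr]
  simp only [tr_apply]
  refine tr_congr fun j l => ?_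
  simp only [Conn.ext_nab, Pi.sub_apply, Finset.sum_apply, Pi.smul_apply, smul_eq_mul, conn0_nab]
  ring

lemma nab_tr13 (i a b c : Fin n) (T : Fin n → Fin n → Fin n → Fin n → Fin n → A) :
    S.conn3.nab i (fun a b c => S.tr fun p q => T p a q b c) a b c =
      S.tr fun p q => S.conn5.nab i T p a q b c := by
  have h : (fun a b c => S.tr fun p q => T p a q b c) = S.tr fun p q a b c => T p a q b c := by
    ext a b c
    simp only [tr_apply]
  rw [h, Conn.nab_tr]
  simp only [tr_apply]
  refine tr_congr fun j l => ?_
  simp only [Conn.ext_nab, Pi.sub_apply, Finset.sum_apply, Pi.smul_apply, smul_eq_mul, conn0_nab]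
  ring

lemma hess_tr24 (a b i k : Fin n) (T : Fin n → Fin n → Fin n → Fin n → A) :
    S.conn2.hess a b (fun i k => S.tr fun j l => T i j k l) i k =
      S.tr fun j l => S.conn4.hess a b T i j k l := by
  have h (c : Fin n) : S.conn2.nab c (fun i k => S.tr fun j l => T i j k l) =
      fun i k => S.tr fun j l => S.conn4.nab c T i j k l := by
    ext i k
    exact S.nab_tr24 c i k T
  simp only [Conn.hess, h, Pi.sub_apply, nab_tr24, Finset.sum_apply, Pi.smul_apply, tr_sub,
    tr_sum, tr_smul]

lemma lap_tr24 (i k : Fin n) (T : Fin n → Fin n → Fin n → Fin n → A) :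
    S.conn2.lap (fun i k => S.tr fun j l => T i j k l) i k =
      S.tr fun j l => S.conn4.lap T i j k l := by
  simp only [Conn.lap, tr_apply, hess_tr24]
  exact S.tr_tr_comm _

lemma nab_rc (p i k : Fin n) :
    S.conn2.nab p S.rc i k = S.tr fun j l => S.conn4.nab p S.rm i j k l :=
  S.nab_tr24 p i k S.rm

lemma lap_rc (i k : Fin n) : S.conn2.lap S.rc i k = S.tr fun j l => S.conn4.lap S.rm i j k l :=
  S.lap_tr24 i k S.rm

lemma lap_sc : S.conn0.lap S.sc = S.tr (S.conn2.lap S.rc) := S.conn0.lap_tr S.rc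

lemma div_rm (j k l : Fin n) : S.tr (fun p q => S.conn4.nab p S.rm j q k l) =
    S.conn2.nab l S.rc k j - S.conn2.nab k S.rc l j := by
  rw [nab_rc, nab_rc, ← tr_sub]
  refine tr_congr fun p q => ?_
  have h := S.nab_rm_cyc p k l j q
  rw [S.nab_rm_pair p j q k l, S.nab_rm_swap12 l k p j q] at h
  linear_combination h

end Bianchi

/-! ### Hamilton's formula for the Laplacian of curvature -/

section Laplacian

/-- The quadratic expression `B_{ijkl} = g^{pq} g^{rs} R_{ipjr} R_{kqls}`. -/
def tB (i j k l : Fin n) : A :=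
  S.tr fun p q => S.tr fun r s => S.rm i p j r * S.rm k q l s

lemma tB_pair (i j k l : Fin n) : S.tB k l i j = S.tB i j k l := by
  rw [tB, ← S.tr_flip]
  refine tr_congr fun p q => ?_
  rw [← S.tr_flip]
  exact tr_congr fun r s => mul_comm _ _

lemma rm_sub_rm (i p j r : Fin n) : S.rm i p j r - S.rm j p i r = S.rm i j p r := by
  have h := S.rm_cyc i j p r
  rw [S.rm_swap12 i p] at h
  linear_combination -h

/-- The first Bianchi identity in the second factor turns `R_{kqls} - R_{lqks}` into `R_{klqs}`. The
resulting sum is antisymmetric in `i, j`, so averaging it with its swap allows the same step in the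
first factor. -/
lemma two_mul_tB_sub (i j k l : Fin n) : 2 * (S.tB i j k l - S.tB i j l k) =
    S.tr fun p q => S.tr fun r s => S.rm i j p r * S.rm k l q s := by
  have h1 : S.tB i j k l - S.tB i j l k =
      S.tr fun p q => S.tr fun r s => S.rm i p j r * S.rm k l q s := by
    simp only [tB, ← tr_sub, ← mul_sub, rm_sub_rm]
  have h2 : S.tB i j k l - S.tB i j l k =
      -S.tr fun p q => S.tr fun r s => S.rm j p i r * S.rm k l q s := by
    rw [h1, tr_tr_comm, ← tr_neg]
    refine tr_congr fun p q => ?_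
    rw [← tr_neg]
    refine tr_congr fun r s => ?_
    rw [S.rm_swap34 k l q s, S.rm_pair j p i r]
    ring
  rw [two_mul]
  nth_rw 1 [h1]
  rw [h2, ← sub_eq_add_neg]
  simp only [← tr_sub, ← sub_mul, rm_sub_rm]

/-- The Ricci identity gives one term for each index of `R_{jqkl}`. Index `q`, contracted with `p`,
gives the Ricci term; `k` and `l` give the two `B` terms. -/
lemma tr_hess_sub (i j k l : Fin n) :
    S.tr (fun p q => S.conn4.hess p i S.rm j q k l - S.conn4.hess i p S.rm j q k l) =
      S.tr (fun p q => S.tr fun r s => S.rm p i j r * S.rm s q k l)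
      + S.tr (fun r s => S.rc i r * S.rm j s k l)
      + S.tB i k j l - S.tB i l j k := by
  have h : S.tr (fun r s => S.rc i r * S.rm j s k l) =
      S.tr fun p q => S.tr fun r s => S.rm p i q r * S.rm j s k l := by
    rw [tr_tr_comm]
    refine tr_congr fun r s => ?_
    rw [rc, ← tr_mul_right]
    refine tr_congr fun p q => ?_
    rw [S.rm_swap12 i p, S.rm_swap34 i p r q, neg_neg]
  have h3 : S.tB i k j l = S.tr fun p q => S.tr fun r s => S.rm p i k r * S.rm j q s l := by
    refine tr_congr fun p q => tr_congr fun r s => ?_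
    rw [S.rm_swap12 i p k r, S.rm_swap34 j q l s]
    ring
  have h4 : S.tB i l j k = -S.tr fun p q => S.tr fun r s => S.rm p i l r * S.rm j q k s := by
    simp only [← tr_neg]
    refine tr_congr fun p q => tr_congr fun r s => ?_
    rw [S.rm_swap12 i p l r]
    ring
  simp only [hess_conn4_sub, tr_add, h, h3, h4]
  ring

lemma hess_rm_cyc (p q i j k l : Fin n) : S.conn4.hess p q S.rm i j k l +
    S.conn4.hess p i S.rm j q k l + S.conn4.hess p j S.rm q i k l = 0 := by
  set V : Fin n → Fin n → Fin n → Fin n → Fin n → A := fun q => S.conn4.nab q S.rm with hV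
  have h : V + (fun q i j k l => V i j q k l) + (fun q i j k l => V j q i k l) = 0 := by
    ext q i j k l
    exact S.nab_rm_cyc q i j k l
  have h2 := congrArg (S.conn5.nab p) h
  rw [map_zero, map_add, map_add] at h2
  have h3 := congrFun (congrFun (congrFun (congrFun (congrFun h2 q) i) j) k) l
  simp only [Conn.hess_eq]
  rw [← hV]
  refine Eq.trans ?_ h3
  simp only [Conn.ext_nab, Pi.add_apply, Pi.sub_apply, Finset.sum_apply, Pi.smul_apply,
    smul_eq_mul, conn0_nab]
  ring

lemma hess_rm_swap12 (a b i j k l : Fin n) :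
    S.conn4.hess a b S.rm j i k l = -S.conn4.hess a b S.rm i j k l := by
  have h (b : Fin n) : S.conn4.nab b S.rm = -fun i j k l => S.conn4.nab b S.rm j i k l := by
    ext i j k l; simp [S.nab_rm_swap12 b i j k l]
  simp only [Conn.hess, Pi.sub_apply, Finset.sum_apply, Pi.smul_apply, S.nab_rm_swap12 _ i j k l]
  have h2 : S.conn4.nab a (S.conn4.nab b S.rm) j i k l =
      -S.conn4.nab a (S.conn4.nab b S.rm) i j k l := by
    conv_lhs => rw [h, map_neg]
    generalize S.conn4.nab b S.rm = V
    simp only [Conn.ext_nab, Pi.neg_apply, Pi.sub_apply, Finset.sum_apply, Pi.smul_apply,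
      smul_eq_mul, conn0_nab]
    ring
  rw [h2]
  simp only [smul_neg, Finset.sum_neg_distrib]
  ring

lemma tr_hess_div (i j k l : Fin n) : S.tr (fun p q => S.conn4.hess i p S.rm j q k l) =
    S.conn2.hess i l S.rc k j - S.conn2.hess i k S.rc l j := by
  have h := S.nab_tr13 i j k l fun p => S.conn4.nab p S.rm
  simp only [div_rm] at h
  simp only [Conn.hess_eq] at h ⊢
  rw [← h]
  have key (V : Fin n → Fin n → Fin n → A) :
      S.conn3.nab i (fun a b c => V c b a - V b c a) j k l =
        S.conn3.nab i V l k j - S.conn3.nab i V k l j := by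
    rw [show (fun a b c => V c b a - V b c a) =
      (fun a b c => V c b a) - fun a b c => V b c a from rfl, map_sub]
    simp only [Conn.ext_nab, Pi.sub_apply, Finset.sum_apply, Pi.smul_apply, smul_eq_mul, conn0_nab]
    ring
  exact key fun l => S.conn2.nab l S.rc

/-- Hamilton's formula for the Laplacian of the curvature tensor. -/
theorem lap_rm (i j k l : Fin n) : S.conn4.lap S.rm i j k l
      + 2 * (S.tB i j k l - S.tB i j l k - S.tB i l j k + S.tB i k j l)
      - S.tr (fun p q => S.rm p j k l * S.rc q i) - S.tr (fun p q => S.rm i p k l * S.rc q j) =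
    S.conn2.hess i k S.rc l j - S.conn2.hess i l S.rc k j - S.conn2.hess j k S.rc l i
      + S.conn2.hess j l S.rc k i := by
  -- The differentiated Bianchi identity trades `∇_p ∇_q R_{ijkl}` for derivatives that become
  -- divergences once `∇_p` is moved inside.
  have h0 : S.conn4.lap S.rm i j k l = S.tr (fun p q => S.conn4.hess p j S.rm i q k l) -
      S.tr fun p q => S.conn4.hess p i S.rm j q k l := by
    simp only [Conn.lap, tr_apply, ← tr_sub]
    refine tr_congr fun p q => ?_
    have h := S.hess_rm_cyc p q i j k l
    rw [S.hess_rm_swap12 p j i q k l] at h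
    linear_combination h
  have h1 := S.tr_hess_sub i j k l
  have h2 := S.tr_hess_sub j i k l
  rw [tr_sub, tr_hess_div] at h1 h2
  -- The terms from the first index of `Rm` are antisymmetrised in `i, j`, which makes a difference
  -- of `B`s.
  have h3 : S.tr (fun p q => S.tr fun r s => S.rm p i j r * S.rm s q k l) -
      S.tr (fun p q => S.tr fun r s => S.rm p j i r * S.rm s q k l) =
      2 * (S.tB i j k l - S.tB i j l k) := by
    simp only [two_mul_tB_sub, ← tr_sub, ← sub_mul]
    refine tr_congr fun p q => tr_congr fun r s => ?_
    have h := S.rm_sub_rm i p j r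
    rw [S.rm_swap12 i p, S.rm_swap12 j p, S.rm_swap34 k l s q, S.rm_pair k l s q, ← h,
      S.rm_swap12 p i, S.rm_swap12 p j]
    ring
  have h4 : S.tr (fun p q => S.rm p j k l * S.rc q i) =
      -S.tr fun r s => S.rc i r * S.rm j s k l := by
    rw [← tr_flip, ← tr_neg]
    refine tr_congr fun p q => ?_
    rw [S.rm_swap12 j q, S.rc_symm i p]
    ring
  have h5 : S.tr (fun p q => S.rm i p k l * S.rc q j) =
      S.tr fun r s => S.rc j r * S.rm i s k l := by
    rw [← tr_flip]
    refine tr_congr fun p q => ?_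
    rw [S.rc_symm j p]
    ring
  rw [h0, h4, h5]
  rw [S.tB_pair i l j k, S.tB_pair i k j l] at h2
  linear_combination h2 - h1 - h3

/-- The last two terms have equal traces, so the claim is `tr B_{ijkl} = 2 tr B_{ijlk}`. Two
expressions for `tr B_{ijlk}`, added and combined by the first Bianchi identity, give
`two_mul_tB_sub` traced. -/
lemma tr_tB_sub (i k : Fin n) :
    S.tr (fun j l => S.tB i j k l - S.tB i j l k - S.tB i l j k) = 0 := by
  have h1 : S.tr (fun j l => S.tB i l j k) = S.tr fun j l => S.tB i j l k := S.tr_flip _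
  have h2 : S.tr (fun j l => S.tB i j l k) = S.tr fun j l => S.tr fun p q => S.tr fun r s =>
      S.rm i j p r * S.rm k s q l := by
    simp only [tB]
    rw [tr_tr_comm]
    exact tr_congr fun p q => tr_congr fun j l => tr_congr fun r s => by rw [S.rm_pair l q]
  have h3 : S.tr (fun j l => S.tB i j l k) = -S.tr fun j l => S.tr fun p q => S.tr fun r s =>
      S.rm i j p r * S.rm k q s l := by
    rw [h2, ← tr_neg]
    refine tr_congr fun j l => ?_
    rw [tr_tr_comm, ← tr_neg]
    refine tr_congr fun p q => ?_
    rw [← tr_neg]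
    refine tr_congr fun r s => ?_
    rw [S.rm_swap34 i j p r]
    ring
  have h4 : 2 * S.tr (fun j l => S.tB i j l k) =
      2 * S.tr (fun j l => S.tB i j k l - S.tB i j l k) := by
    rw [two_mul]
    nth_rw 1 [h2]
    rw [h3, ← sub_eq_add_neg, ← tr_mul_left]
    simp only [two_mul_tB_sub, ← tr_sub, ← mul_sub]
    refine tr_congr fun j l => tr_congr fun p q => tr_congr fun r s => ?_
    have h := S.rm_cyc s q k l
    rw [S.rm_swap12 k q, ← S.rm_pair s q k l, S.rm_swap34 k l q s] at h
    linear_combination S.rm i j p r * h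
  rw [tr_sub, h1, ← two_mul_cancel h4, sub_self]

lemma tr_tB (i k : Fin n) :
    S.tr (fun j l => S.tB i j k l - S.tB i j l k - S.tB i l j k + S.tB i k j l) =
      S.tr fun p q => S.tr fun r s => S.rm p i r k * S.rc q s := by
  rw [tr_add, tr_tB_sub, zero_add]
  unfold tB
  rw [tr_tr_comm]
  refine tr_congr fun p q => ?_
  rw [tr_tr_comm]
  refine tr_congr fun r s => ?_
  rw [tr_mul_left, rc, S.rm_swap12 i p, S.rm_swap34 i p k r, neg_neg]
  congr 1
  refine tr_congr fun j l => ?_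
  rw [S.rm_swap12 q j, S.rm_swap34 q j s l, neg_neg]

end Laplacian

/-! ### First variation of the curvature -/

section Variation

variable (D : Derivation ℝ A A)

lemma derivation_sum {ι : Type*} (s : Finset ι) (f : ι → A) :
    D (∑ i ∈ s, f i) = ∑ i ∈ s, D (f i) := map_sum D f s

lemma two_mul_half_smul (a : A) : 2 * ((1 / 2 : ℝ) • a) = a := by
  rw [mul_smul_comm, two_mul, ← two_smul ℝ a, smul_smul]; norm_num

/-- The variation of the Christoffel symbols. -/
lemma two_mul_sum_g_mul_derivation_chr (hD : ∀ i a, D (S.d i a) = S.d i (D a)) (i j k : Fin n) :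
    2 * ∑ l, S.g k l * D (S.chr i j l) =
      S.conn2.nab i (fun i j => D (S.g i j)) j k + S.conn2.nab j (fun i j => D (S.g i j)) i k -
        S.conn2.nab k (fun i j => D (S.g i j)) i j := by
  have h := congrArg D (congrArg (2 * ·) (S.sum_g_mul_chr i j k))
  simp only [two_mul_half_smul, map_add, map_sub, hD] at h
  rw [two_mul, map_add, map_sum] at h
  simp only [Derivation.leibniz, smul_eq_mul, Finset.sum_add_distrib] at h
  simp only [Conn.ext_nab, Pi.sub_apply, Finset.sum_apply, Pi.smul_apply, smul_eq_mul, conn0_nab,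
    S.chr_symm j i, S.chr_symm k i, S.chr_symm k j]
  have e1 : ∑ m, S.chr i j m * D (S.g m k) = ∑ m, S.chr i j m * D (S.g k m) :=
    Finset.sum_congr rfl fun m _ => by rw [S.g_symm]
  have e2 : ∑ m, S.chr i k m * D (S.g m j) = ∑ m, S.chr i k m * D (S.g j m) :=
    Finset.sum_congr rfl fun m _ => by rw [S.g_symm]
  rw [e1, e2]
  linear_combination h

/-- The variation of the curvature tensor in terms of that of the Christoffel symbols. -/
lemma sum_g_mul_derivation_rm31 (hD : ∀ i a, D (S.d i a) = S.d i (D a)) (i j k s : Fin n) :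
    ∑ m, S.g s m * D (S.rm31 i j k m) =
      S.conn3.nab j (fun i k s => ∑ l, S.g s l * D (S.chr i k l)) i k s -
        S.conn3.nab i (fun i k s => ∑ l, S.g s l * D (S.chr i k l)) j k s := by
  -- The last sum is symmetric in `i, j` because `Γ` is, so it drops out of the difference.
  have key (i j : Fin n) : S.conn3.nab j (fun i k s => ∑ l, S.g s l * D (S.chr i k l)) i k s =
      ∑ l, S.g s l * S.d j (D (S.chr i k l)) +
      ∑ l, S.g s l * ∑ m, D (S.chr i k m) * S.chr j m l
      - ∑ l, S.g s l * ∑ m, S.chr j k m * D (S.chr i m l)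
      - ∑ l, S.g s l * ∑ m, S.chr j i m * D (S.chr m k l) := by
    have h1 : ∑ l, (∑ m, S.chr j s m * S.g m l) * D (S.chr i k l) =
        ∑ m, S.chr j s m * ∑ l, S.g m l * D (S.chr i k l) := by
      simp only [Finset.sum_mul, Finset.mul_sum, mul_assoc]
      exact Finset.sum_comm
    have h2 : ∑ l, (∑ m, S.chr j l m * S.g s m) * D (S.chr i k l) =
        ∑ l, S.g s l * ∑ m, D (S.chr i k m) * S.chr j m l := by
      simp only [Finset.sum_mul, Finset.mul_sum]
      rw [Finset.sum_comm]
      simp only [mul_assoc, mul_left_comm, mul_comm]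
    have h3 (f : Fin n → A) (F : Fin n → Fin n → A) :
        ∑ m, f m * ∑ l, S.g s l * F m l = ∑ l, S.g s l * ∑ m, f m * F m l := by
      simp only [Finset.mul_sum]
      rw [Finset.sum_comm]
      simp only [mul_left_comm]
    simp only [Conn.ext_nab, Pi.sub_apply, Finset.sum_apply, Pi.smul_apply, smul_eq_mul, conn0_nab,
      derivation_sum, Derivation.leibniz, Finset.sum_add_distrib, S.d_g j s, mul_comm (D _) (_ + _),
      add_mul, h1, h2]
    rw [← h3 (S.chr j k) fun m l => D (S.chr i m l), ← h3 (S.chr j i) fun m l => D (S.chr m k l)]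
    ring
  rw [key, key]
  simp only [rm31, map_add, map_sub, hD, derivation_sum, Derivation.leibniz, smul_eq_mul,
    Finset.sum_sub_distrib, Finset.sum_add_distrib, mul_add, mul_sub, S.chr_symm j i]
  simp only [mul_comm (D _)]
  simp only [mul_comm (S.chr _ _ _) (D _)]
  ring

/-- The variation of the curvature tensor. -/
lemma two_mul_derivation_rm (hD : ∀ i a, D (S.d i a) = S.d i (D a)) (h : Fin n → Fin n → A)
    (hh : ∀ i j, D (S.g i j) = h i j) (i j k l : Fin n) :
    2 * D (S.rm i j k l) =
      S.tr (fun p q => S.rm i j k p * h q l) - S.tr (fun p q => S.rm i j l p * h q k) +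
      S.conn2.hess j k h i l - S.conn2.hess j l h i k - S.conn2.hess i k h j l +
        S.conn2.hess i l h j k := by
  have hs (i j : Fin n) : h i j = h j i := by rw [← hh, ← hh, S.g_symm]
  -- The variation of `Γ` with its upper index lowered; unlike `Γ` it is a tensor, and `2W` is the
  -- Koszul expression in `∇h`.
  set W : Fin n → Fin n → Fin n → A := fun i k s => ∑ l, S.g s l * D (S.chr i k l) with hW
  have h1 : D (S.rm i j k l) = S.tr (fun p q => S.rm i j k p * h q l) +
      (S.conn3.nab j W i k l - S.conn3.nab i W j k l) := by
    rw [hW, ← S.sum_g_mul_derivation_rm31 D hD]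
    have := S.sum_rm31_smul i j k fun q => h q l
    simp only [smul_eq_mul] at this
    rw [← this]
    simp only [rm, derivation_sum, Derivation.leibniz, smul_eq_mul, Finset.sum_add_distrib, hh,
      hs l]
    ring
  have h2 : W + W = (fun i k s => S.conn2.nab i h k s) + (fun i k s => S.conn2.nab k h i s) -
      fun i k s => S.conn2.nab s h i k := by
    ext i k s
    have := S.two_mul_sum_g_mul_derivation_chr D hD i k s
    simp only [hh] at this
    rw [two_mul] at this
    exact this
  have h3 (a b c e : Fin n) : 2 * S.conn3.nab a W b c e =
      S.conn2.hess a b h c e + S.conn2.hess a c h b e - S.conn2.hess a e h b c := by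
    have h4 := congrFun (congrFun (congrFun (congrArg (S.conn3.nab a) h2) b) c) e
    rw [map_sub, map_add, map_add] at h4
    rw [two_mul]
    refine h4.trans ?_
    have key (V : Fin n → Fin n → Fin n → A) :
        S.conn3.nab a (fun i k s => V i k s) b c e + S.conn3.nab a (fun i k s => V k i s) b c e -
          S.conn3.nab a (fun i k s => V s i k) b c e =
        S.conn3.nab a V b c e + S.conn3.nab a V c b e - S.conn3.nab a V e b c := by
      simp only [Conn.ext_nab, Pi.sub_apply, Finset.sum_apply, Pi.smul_apply, smul_eq_mul,
        conn0_nab]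
      ring
    exact key fun i => S.conn2.nab i h
  -- The pair `∇_j ∇_i h_{kl} - ∇_i ∇_j h_{kl}` is a commutator. It removes one of the two copies of
  -- `R_{ijkp} h_{ql}` and produces the term with `k, l` exchanged.
  have h5 := S.hess_conn2_sub j i k l h
  have h6 : S.tr (fun p q => S.rm j i k p * h q l) = -S.tr (fun p q => S.rm i j k p * h q l) := by
    rw [← tr_neg]
    exact tr_congr fun p q => by rw [S.rm_swap12 i j]; ring
  have h7 : S.tr (fun p q => S.rm j i l p * h k q) = -S.tr (fun p q => S.rm i j l p * h q k) := by
    rw [← tr_neg]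
    exact tr_congr fun p q => by rw [S.rm_swap12 i j, hs k]; ring
  rw [h6, h7] at h5
  linear_combination 2 * h1 + h3 j i k l - h3 i j k l + h5

end Variation

/-! ### Evolution equations under the flow -/

section Evolution

variable {S} in
lemma Conn.hess_add {X : Type*} [AddCommGroup X] [Module A X] (N : S.Conn X) (i j : Fin n)
    (x y : X) : N.hess i j (x + y) = N.hess i j x + N.hess i j y := by
  simp only [Conn.hess, map_add, smul_add, Finset.sum_add_distrib]
  abel

variable {S} in
lemma Conn.hess_const_smul {X : Type*} [AddCommGroup X] [Module A X] (N : S.Conn X) (i j : Fin n)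
    {c : A} (hc : ∀ i, S.d i c = 0) (x : X) : N.hess i j (c • x) = c • N.hess i j x := by
  simp only [Conn.hess, N.leibniz, hc, zero_smul, zero_add, smul_sub, Finset.smul_sum,
    smul_comm c]

lemma hess_smul_g (i j : Fin n) (f : A) :
    S.conn2.hess i j (f • S.g) = S.conn0.hess i j f • S.g := by
  simp only [Conn.hess, Conn.leibniz, nab_g, smul_zero, add_zero, conn0_nab, sub_smul,
    Finset.sum_smul, smul_smul, smul_eq_mul]

lemma hess_rc_symm (a b i j : Fin n) :
    S.conn2.hess a b S.rc i j = S.conn2.hess a b S.rc j i := by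
  have key (b : Fin n) (T : Fin n → Fin n → A) (hT : T = fun i j => T j i) :
      S.conn2.nab b T = fun i j => S.conn2.nab b T j i := by
    ext i j
    conv_lhs => rw [hT]
    simp only [Conn.ext_nab, Pi.sub_apply, Finset.sum_apply, Pi.smul_apply, smul_eq_mul, conn0_nab]
    ring
  have h1 (b : Fin n) := key b S.rc (funext fun i => funext fun j => S.rc_symm i j)
  have h2 := key a _ (h1 b)
  simp only [Conn.hess, Pi.sub_apply, Finset.sum_apply, Pi.smul_apply]
  rw [congrFun (congrFun h2 i) j]
  refine congrArg _ (Finset.sum_congr rfl fun m _ => ?_)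
  rw [congrFun (congrFun (h1 m) i) j]

/-- The correction term is the variation of `g^{-1}`, namely `-g^{-1} (Dg) g^{-1}`. -/
lemma derivation_tr (D : Derivation ℝ A A) (T : Fin n → Fin n → A) :
    D (S.tr T) = S.tr (fun p q => D (T p q)) -
      S.tr fun a j => S.tr fun b l => D (S.g a b) * T j l := by
  have h1 : S.tr (fun a j => S.tr fun b l => D (S.g a b) * T j l) =
      ∑ j, ∑ l, (∑ a, ∑ b, S.gu j a * D (S.g a b) * S.gu b l) * T j l := by
    simp only [tr, smul_eq_mul, Finset.sum_mul, Finset.mul_sum]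
    rw [Finset.sum_comm]
    refine Finset.sum_congr rfl fun j _ => ?_
    rw [Finset.sum_comm' (t' := Finset.univ) (s' := fun _ => Finset.univ) (by simp)]
    refine (Finset.sum_congr rfl fun b _ => Finset.sum_comm).trans ?_
    rw [Finset.sum_comm]
    refine Finset.sum_congr rfl fun l _ => ?_
    rw [Finset.sum_comm]
    refine Finset.sum_congr rfl fun a _ => Finset.sum_congr rfl fun b _ => ?_
    rw [S.gu_symm a j]
    ring
  rw [h1]
  simp only [tr, derivation_sum, Derivation.leibniz, smul_eq_mul, S.derivation_gu D,
    Finset.sum_add_distrib, neg_mul, Finset.sum_neg_distrib, mul_comm (T _ _)]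
  ring

variable (D : Derivation ℝ A A) (hD : ∀ i a, D (S.d i a) = S.d i (D a)) (c : A)
  (hc : ∀ i, S.d i c = 0)
  (hflow : ∀ i j, D (S.g i j) = -2 * (S.rc i j - c * (S.sc * S.g i j)))

include hD hc hflow

/-- The evolution of the curvature tensor under the Ricci-Bourguignon flow. -/
theorem derivation_rm (i j k l : Fin n) :
    D (S.rm i j k l) = S.conn4.lap S.rm i j k l
      + 2 * (S.tB i j k l - S.tB i j l k - S.tB i l j k + S.tB i k j l)
      - S.tr (fun p q => S.rm p j k l * S.rc q i + S.rm i p k l * S.rc q j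
          + S.rm i j p l * S.rc q k + S.rm i j k p * S.rc q l)
      - c * (S.conn0.hess i k S.sc * S.g j l - S.conn0.hess i l S.sc * S.g j k
          - S.conn0.hess j k S.sc * S.g i l + S.conn0.hess j l S.sc * S.g i k)
      + 2 * c * S.sc * S.rm i j k l := by
  set h : Fin n → Fin n → A := (-2 : A) • S.rc + (2 : A) • c • S.sc • S.g with hh
  have hg (i j : Fin n) : D (S.g i j) = h i j := by
    rw [hflow, hh]
    simp only [Pi.add_apply, Pi.smul_apply, smul_eq_mul]
    ring
  have h2 (i : Fin n) : S.d i (2 : A) = 0 := by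
    exact_mod_cast (S.d i).map_natCast 2
  have hhess (a b i j : Fin n) : S.conn2.hess a b h i j =
      -2 * S.conn2.hess a b S.rc i j + 2 * c * S.conn0.hess a b S.sc * S.g i j := by
    rw [hh, Conn.hess_add, Conn.hess_const_smul _ _ _ (by simp [h2]),
      Conn.hess_const_smul _ _ _ h2, Conn.hess_const_smul _ _ _ hc, hess_smul_g]
    simp only [Pi.add_apply, Pi.smul_apply, smul_eq_mul]
    ring
  have htr (i j k l : Fin n) : S.tr (fun p q => S.rm i j k p * h q l) =
      -2 * S.tr (fun p q => S.rm i j k p * S.rc q l) + 2 * c * S.sc * S.rm i j k l := by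
    rw [← S.tr_mul_g (fun p => S.rm i j k p) l, ← tr_mul_left, ← tr_mul_left, ← tr_add]
    refine tr_congr fun p q => ?_
    simp only [hh, Pi.add_apply, Pi.smul_apply, smul_eq_mul]
    ring
  have h3 : S.tr (fun p q => S.rm i j l p * S.rc q k) =
      -S.tr (fun p q => S.rm i j p l * S.rc q k) := by
    rw [← tr_neg]
    exact tr_congr fun p q => by rw [S.rm_swap34 i j p l]; ring
  have hlap := S.lap_rm i j k l
  apply two_mul_cancel
  rw [S.two_mul_derivation_rm D hD h hg, htr, htr, h3, S.rm_swap34 i j k l]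
  simp only [hhess, tr_add]
  rw [S.hess_rc_symm i k l j, S.hess_rc_symm i l k j, S.hess_rc_symm j k l i,
    S.hess_rc_symm j l k i] at hlap
  -- The Hessians of `Ric` add up to twice the right side of `lap_rm`. That formula supplies the
  -- Ricci terms on `i, j`; those on `k, l` come from the `Rm * h` terms.
  linear_combination -2 * hlap

/-- The evolution of the Ricci tensor under the Ricci-Bourguignon flow. -/
theorem derivation_rc (i k : Fin n) :
    D (S.rc i k) = S.conn2.lap S.rc i k
      + 2 * S.tr (fun p q => S.tr fun r s => S.rm p i r k * S.rc q s)
      - 2 * S.tr (fun p q => S.rc p i * S.rc q k)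
      - (n - 2) * c * S.conn0.hess i k S.sc - c * S.conn0.lap S.sc * S.g i k := by
  have h1 : S.tr (fun a j => S.tr fun b l => D (S.g a b) * S.rm i j k l) =
      -2 * S.tr (fun a j => S.tr fun b l => S.rc a b * S.rm i j k l)
        + 2 * c * S.sc * S.rc i k := by
    have : S.tr (fun a j => S.tr fun b l => S.g a b * S.rm i j k l) = S.rc i k := by
      rw [tr_tr_comm]
      simp only [tr_g_mul]
      rfl
    rw [← this, ← tr_mul_left, ← tr_mul_left, ← tr_add]
    refine tr_congr fun a j => ?_
    rw [← tr_mul_left, ← tr_mul_left, ← tr_add]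
    refine tr_congr fun b l => ?_
    rw [hflow]
    ring
  have h2 : S.tr (fun j l => S.tr fun p q => S.rm p j k l * S.rc q i) =
      S.tr fun p q => S.rc p i * S.rc q k := by
    rw [tr_tr_comm, ← tr_flip]
    refine tr_congr fun p q => ?_
    rw [tr_mul_right, mul_comm]
    rfl
  have h3 : S.tr (fun j l => S.tr fun p q => S.rm i p k l * S.rc q j) =
      S.tr (fun a j => S.tr fun b l => S.rc a b * S.rm i j k l) := by
    rw [tr_tr_comm, ← tr_flip]
    refine tr_congr fun p q => tr_congr fun j l => ?_
    rw [mul_comm]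
  have h4 : S.tr (fun j l => S.tr fun p q => S.rm i j p l * S.rc q k) =
      S.tr fun p q => S.rc p i * S.rc q k := by
    rw [tr_tr_comm]
    refine tr_congr fun p q => ?_
    rw [tr_mul_right, S.rc_symm p i]
    rfl
  have h5 : S.tr (fun j l => S.tr fun p q => S.rm i j k p * S.rc q l) =
      S.tr (fun a j => S.tr fun b l => S.rc a b * S.rm i j k l) := by
    rw [← tr_flip]
    refine tr_congr fun a j => ?_
    rw [← tr_flip]
    refine tr_congr fun b l => ?_
    rw [S.rc_symm, mul_comm]
  have h6 : S.tr (fun j l => S.conn0.hess i k S.sc * S.g j l - S.conn0.hess i l S.sc * S.g j k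
          - S.conn0.hess j k S.sc * S.g i l + S.conn0.hess j l S.sc * S.g i k) =
      (n - 2) * S.conn0.hess i k S.sc + S.conn0.lap S.sc * S.g i k := by
    have e1 : S.tr (fun j l => S.conn0.hess i l S.sc * S.g j k) = S.conn0.hess i k S.sc := by
      rw [← tr_flip]
      exact S.tr_mul_g (fun l => S.conn0.hess i l S.sc) k
    rw [tr_add, tr_sub, tr_sub, e1, tr_mul_left, tr_mul_right,
      S.tr_mul_g' (fun j => S.conn0.hess j k S.sc) i]
    rw [show S.tr (fun j l => S.g j l) = n from S.tr_g]
    rw [Conn.lap]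
    ring
  have hB := S.tr_tB i k
  -- Two of the four `Rm * Ric` terms contract to `Ric * Ric`. The other two, and `2ρ R Ric`, cancel
  -- against the variation of `g^{jl}`.
  conv_lhs => rw [rc, derivation_tr, h1]
  simp only [S.derivation_rm D hD c hc hflow]
  rw [tr_add, tr_sub, tr_sub, tr_add, tr_mul_left, tr_mul_left, tr_mul_left, hB, h6, ← lap_rc]
  simp only [tr_add]
  rw [h2, h3, h4, h5]
  have h7 : S.tr (fun j l => S.rm i j k l) = S.rc i k := rfl
  have h8 : S.tr (fun a j => S.tr fun b l => S.rc a b * S.rm i j k l) =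
      S.tr (fun p q => S.tr fun r s => S.rm p i r k * S.rc q s) := by
    rw [← tr_flip]
    refine tr_congr fun p q => ?_
    rw [← tr_flip]
    refine tr_congr fun r s => ?_
    rw [S.rm_swap12 i p, S.rm_swap34 i p k r, neg_neg, mul_comm]
  rw [h7, h8]
  ring

/-- The evolution of the scalar curvature under the Ricci-Bourguignon flow. -/
theorem derivation_sc :
    D S.sc = (1 - 2 * (n - 1) * c) * S.conn0.lap S.sc
      + 2 * S.tr (fun i j => S.tr fun k l => S.rc i k * S.rc j l) - 2 * c * S.sc ^ 2 := by
  have h1 : S.tr (fun a j => S.tr fun b l => D (S.g a b) * S.rc j l) =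
      -2 * S.tr (fun a j => S.tr fun b l => S.rc a b * S.rc j l) + 2 * c * S.sc * S.sc := by
    have : S.tr (fun a j => S.tr fun b l => S.g a b * S.rc j l) = S.sc := by
      rw [tr_tr_comm]
      simp only [tr_g_mul]
      rfl
    conv_rhs => enter [2, 2]; rw [← this]
    rw [← tr_mul_left, ← tr_mul_left, ← tr_add]
    refine tr_congr fun a j => ?_
    rw [← tr_mul_left, ← tr_mul_left, ← tr_add]
    refine tr_congr fun b l => ?_
    rw [hflow]
    ring
  have h2 : S.tr (fun i k => S.tr fun p q => S.tr fun r s => S.rm p i r k * S.rc q s) =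
      S.tr (fun i j => S.tr fun k l => S.rc i k * S.rc j l) := by
    rw [tr_tr_comm]
    refine tr_congr fun p q => ?_
    rw [tr_tr_comm]
    refine tr_congr fun r s => ?_
    rw [tr_mul_right]
    rfl
  have h3 : S.tr (fun i k => S.tr fun p q => S.rc p i * S.rc q k) =
      S.tr (fun i j => S.tr fun k l => S.rc i k * S.rc j l) := by
    rw [tr_tr_comm]
  have h4 : S.tr (fun i k => S.conn0.hess i k S.sc) = S.conn0.lap S.sc := rfl
  have h5 : S.tr (fun i k => S.g i k) = n := S.tr_g
  have h6 : S.tr (fun i k => S.conn2.lap S.rc i k) = S.conn0.lap S.sc := S.lap_sc.symm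
  -- The coefficient of `-ρ ΔR` is `(n - 2) + n`. The two `|Ric|²` terms of the traced Ricci
  -- equation cancel; the surviving one comes from the variation of `g^{ik}`.
  conv_lhs => rw [sc, derivation_tr, h1]
  simp only [S.derivation_rc D hD c hc hflow]
  simp only [tr_add, tr_sub, tr_mul_left, h2, h3, h4, h5, h6]
  ring

end Evolution

end FormalMetric

/-! ### The algebra of smooth functions on a set and its derivations -/

section SmoothFun

variable {E : Type*} [NormedAddCommGroup E] [NormedSpace ℝ E]

/-- The algebra of smooth functions on a subset of a normed space. -/
def SmoothFun (s : Set E) : Subalgebra ℝ (s → ℝ) where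
  carrier := {f | ∃ F : E → ℝ, ContDiffOn ℝ ∞ F s ∧ ∀ p : s, f p = F p}
  mul_mem' := by
    rintro f f' ⟨F, hF, h⟩ ⟨F', hF', h'⟩
    exact ⟨fun p => F p * F' p, hF.mul hF', fun p => by simp [h, h']⟩
  add_mem' := by
    rintro f f' ⟨F, hF, h⟩ ⟨F', hF', h'⟩
    exact ⟨fun p => F p + F' p, hF.add hF', fun p => by simp [h, h']⟩
  algebraMap_mem' r := ⟨fun _ => r, contDiffOn_const, fun _ => rfl⟩

namespace SmoothFun

variable {s : Set E}

/-- The restriction of a function that is smooth on `s`. -/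
def ofContDiffOn {F : E → ℝ} (hF : ContDiffOn ℝ ∞ F s) : SmoothFun s :=
  ⟨fun p => F p, F, hF, fun _ => rfl⟩

/-- Some extension to the whole space. -/
def extension (a : SmoothFun s) : E → ℝ := a.2.choose

lemma contDiffOn_extension (a : SmoothFun s) : ContDiffOn ℝ ∞ (extension a) s := a.2.choose_spec.1

lemma extension_eq (a : SmoothFun s) (p : s) : extension a p = a.1 p := (a.2.choose_spec.2 p).symm

lemma hasFDerivWithinAt_extension (a : SmoothFun s) (p : s) :
    HasFDerivWithinAt (extension a) (fderivWithin ℝ (extension a) s p) s p :=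
  ((contDiffOn_extension a p p.2).differentiableWithinAt (by simp)).hasFDerivWithinAt

/-- The chosen extension is arbitrary off `s`, but derivatives within `s` depend only on the values
on `s`. -/
lemma fderivWithin_eq (a : SmoothFun s) {F : E → ℝ}
    (h : ∀ p : s, a.1 p = F p) (p : s) : fderivWithin ℝ (extension a) s p = fderivWithin ℝ F s p :=
  fderivWithin_congr (fun q hq => (extension_eq a ⟨q, hq⟩).trans (h ⟨q, hq⟩))
    ((extension_eq a p).trans (h p))

/-- The derivative in the direction `v`. -/
def dirDeriv (hs : UniqueDiffOn ℝ s) (v : E) : Derivation ℝ (SmoothFun s) (SmoothFun s) :=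
  Derivation.mk'
    { toFun := fun a => ofContDiffOn (F := fun p => fderivWithin ℝ (extension a) s p v)
        (((contDiffOn_extension a).fderivWithin hs (m := ∞) (by simp)).clm_apply contDiffOn_const)
      map_add' := fun a b => by
        ext p
        change fderivWithin ℝ (extension (a + b)) s p v =
          fderivWithin ℝ (extension a) s p v + fderivWithin ℝ (extension b) s p v
        rw [fderivWithin_eq (a + b) (F := extension a + extension b)
          (fun q => by simp [extension_eq]) p,
          ((hasFDerivWithinAt_extension a p).add
            (hasFDerivWithinAt_extension b p)).fderivWithin (hs p p.2)]
        rfl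
      map_smul' := fun r a => by
        ext p
        change fderivWithin ℝ (extension (r • a)) s p v = r * fderivWithin ℝ (extension a) s p v
        rw [fderivWithin_eq (r • a) (F := r • extension a)
          (fun q => by simp [extension_eq]) p,
          ((hasFDerivWithinAt_extension a p).const_smul r).fderivWithin (hs p p.2)]
        rfl }
    (fun a b => by
      ext p
      change fderivWithin ℝ (extension (a * b)) s p v =
        a.1 p * fderivWithin ℝ (extension b) s p v + b.1 p * fderivWithin ℝ (extension a) s p v
      rw [fderivWithin_eq (a * b) (F := extension a * extension b)
        (fun q => by simp [extension_eq]) p,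
        ((hasFDerivWithinAt_extension a p).mul
          (hasFDerivWithinAt_extension b p)).fderivWithin (hs p p.2)]
      simp [extension_eq])

lemma dirDeriv_apply (hs : UniqueDiffOn ℝ s) (v : E) (a : SmoothFun s) (p : s) :
    (dirDeriv hs v a).1 p = fderivWithin ℝ (extension a) s p v := rfl

/-- The second derivative within `s` is symmetric at interior points and, by continuity, at their
limits; this covers endpoints of the time interval. -/
lemma dirDeriv_comm (hs : UniqueDiffOn ℝ s) (hs' : s ⊆ closure (interior s)) (v w : E)
    (a : SmoothFun s) : dirDeriv hs v (dirDeriv hs w a) = dirDeriv hs w (dirDeriv hs v a) := by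
  ext p
  have key (v w : E) : (dirDeriv hs v (dirDeriv hs w a)).1 p =
      fderivWithin ℝ (fderivWithin ℝ (extension a) s) s p v w := by
    have hd : DifferentiableWithinAt ℝ (fderivWithin ℝ (extension a) s) s p :=
      ((contDiffOn_extension a).fderivWithin hs (m := ∞) (by simp) p
        p.2).differentiableWithinAt (by simp)
    rw [dirDeriv_apply, fderivWithin_eq _ (F := fun q => fderivWithin ℝ (extension a) s q w)
      (fun q => rfl) p, fderivWithin_clm_apply (hs p p.2) hd (differentiableWithinAt_const _)]
    simp
  rw [key, key]
  exact (contDiffOn_extension a p p.2).isSymmSndFDerivWithinAt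
    (by
      rw [minSmoothness_of_isRCLikeNormedField]
      exact WithTop.coe_le_coe.2 (le_top : (2 : ℕ∞) ≤ ⊤))
    hs (hs' p.2) p.2 v w

/-- Evaluation at a point. -/
def ev (p : s) : SmoothFun s →ₐ[ℝ] ℝ := (Pi.evalAlgHom ℝ _ p).comp (SmoothFun s).val

lemma ev_apply (p : s) (a : SmoothFun s) : ev p a = a.1 p := rfl

lemma isUnit_of_ne_zero (a : SmoothFun s) (h : ∀ p, ev p a ≠ 0) : IsUnit a := by
  refine IsUnit.of_mul_eq_one
    (ofContDiffOn (F := fun p => (extension a p)⁻¹) ((contDiffOn_extension a).inv fun p hp => ?_)) ?_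
  · rw [extension_eq a ⟨p, hp⟩]
    exact h ⟨p, hp⟩
  · ext p
    change a.1 p * (extension a p)⁻¹ = 1
    rw [extension_eq]
    exact mul_inv_cancel₀ (h p)

section Cylinder

variable {n : ℕ} {I : Set ℝ} {U : Set (Coord n)}

lemma hasDerivWithinAt_of_ev (a : SmoothFun (I ×ˢ U)) (hs : UniqueDiffOn ℝ (I ×ˢ U)) (t : ℝ)
    (y : Coord n) (h : (t, y) ∈ I ×ˢ U) {f : ℝ → ℝ}
    (hf : ∀ r, ∀ hr : (r, y) ∈ I ×ˢ U, f r = ev ⟨(r, y), hr⟩ a) :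
    HasDerivWithinAt f (ev ⟨(t, y), h⟩ (dirDeriv hs (1, 0) a)) I t := by
  have h1 : HasDerivWithinAt (fun r : ℝ => (r, y)) ((1 : ℝ), (0 : Coord n)) I t :=
    (hasDerivWithinAt_id t I).prodMk (hasDerivWithinAt_const t I y)
  have h2 := (hasFDerivWithinAt_extension a ⟨(t, y), h⟩).comp_hasDerivWithinAt t h1
    (show MapsTo (fun r : ℝ => (r, y)) I (I ×ˢ U) from fun r hr => ⟨hr, h.2⟩)
  exact h2.congr (fun r hr => (hf r ⟨hr, h.2⟩).trans (extension_eq a ⟨(r, y), ⟨hr, h.2⟩⟩).symm)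
    ((hf t h).trans (extension_eq a ⟨(t, y), h⟩).symm)

/-- The slice at fixed `t` is open in space, so the spatial derivative is an ordinary one even when
`t` is an endpoint of `I`. -/
lemma pd_eq (hU : IsOpen U) (a : SmoothFun (I ×ˢ U)) (hs : UniqueDiffOn ℝ (I ×ˢ U)) (t : ℝ)
    (y : Coord n) (h : (t, y) ∈ I ×ˢ U) {f : Coord n → ℝ}
    (hf : ∀ z, ∀ hz : (t, z) ∈ I ×ˢ U, f z = ev ⟨(t, z), hz⟩ a) (i : Fin n) :
    pd i f y =
      ev ⟨(t, y), h⟩ (dirDeriv hs (0, EuclideanSpace.single i 1) a) := by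
  have h1 : HasFDerivWithinAt (fun z : Coord n => (t, z)) (ContinuousLinearMap.inr ℝ ℝ (Coord n))
      U y := by
    exact (hasFDerivAt_prodMk_right t y).hasFDerivWithinAt
  have h2 := (hasFDerivWithinAt_extension a ⟨(t, y), h⟩).comp y h1
    (show MapsTo (fun z => (t, z)) U (I ×ˢ U) from fun z hz => ⟨h.1, hz⟩)
  have h3 := h2.hasFDerivAt (hU.mem_nhds h.2)
  have h4 : f =ᶠ[nhds y] extension a ∘ fun z => (t, z) := by
    filter_upwards [hU.mem_nhds h.2] with z hz
    exact (hf z ⟨h.1, hz⟩).trans (extension_eq a ⟨(t, z), ⟨h.1, hz⟩⟩).symm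
  rw [pd, (h3.congr_of_eventuallyEq h4).fderiv]
  rfl

lemma interior_nonempty_of_ordConnected (hI : I.OrdConnected) (hI' : I.Nontrivial) :
    (interior I).Nonempty := by
  obtain ⟨a, ha, b, hb, hab⟩ := hI'.exists_lt
  obtain ⟨c, hc⟩ := nonempty_Ioo.2 hab
  exact ⟨c, interior_maximal (Ioo_subset_Icc_self.trans (hI.out ha hb)) isOpen_Ioo hc⟩

lemma uniqueDiffOn_cylinder (hI : I.OrdConnected) (hI' : I.Nontrivial) (hU : IsOpen U) :
    UniqueDiffOn ℝ (I ×ˢ U) :=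
  (uniqueDiffOn_convex hI.convex (interior_nonempty_of_ordConnected hI hI')).prod hU.uniqueDiffOn

lemma cylinder_subset_closure_interior (hI : I.OrdConnected) (hI' : I.Nontrivial)
    (hU : IsOpen U) : I ×ˢ U ⊆ closure (interior (I ×ˢ U)) := by
  rw [interior_prod_eq, closure_prod_eq, hU.interior_eq,
    (hI.convex (𝕜 := ℝ)).closure_interior_eq_closure_of_nonempty_interior
      (interior_nonempty_of_ordConnected hI hI')]
  exact prod_mono subset_closure subset_closure

end Cylinder

end SmoothFun

end SmoothFun

/-! ### Coordinate tensors as values of formal ones -/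

section Evaluation

open SmoothFun

variable {n : ℕ} {I : Set ℝ} {U : Set (Coord n)} (hs : UniqueDiffOn ℝ (I ×ˢ U)) (hU : IsOpen U)
  (S : FormalMetric n (SmoothFun (I ×ˢ U)))
  (hd : ∀ i, S.d i = dirDeriv hs (0, EuclideanSpace.single i 1))
  (t : ℝ) (G : Coord n → Matrix (Fin n) (Fin n) ℝ)
  (hG : ∀ z, ∀ hz : (t, z) ∈ I ×ˢ U, ∀ i j, ev ⟨(t, z), hz⟩ (S.g i j) = G z i j)
  (z : Coord n) (hz : (t, z) ∈ I ×ˢ U)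

include hU hd in
lemma pd_eq_ev_d {f : Coord n → ℝ} {a : SmoothFun (I ×ˢ U)}
    (hf : ∀ z, ∀ hz : (t, z) ∈ I ×ˢ U, f z = ev ⟨(t, z), hz⟩ a) (i : Fin n) :
    pd i f z = ev ⟨(t, z), hz⟩ (S.d i a) := by
  rw [hd, pd_eq hU a hs t z hz hf]

include hG in
lemma inv_apply_eq_ev (i j : Fin n) : (G z)⁻¹ i j = ev ⟨(t, z), hz⟩ (S.gu i j) := by
  have h : (Matrix.of fun i j => ev ⟨(t, z), hz⟩ (S.gu i j)) * G z = 1 := by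
    ext i j
    simp only [Matrix.mul_apply, Matrix.of_apply, ← hG z hz, ← map_mul, ← map_sum, S.gu_mul_g,
      Matrix.one_apply]
    split_ifs <;> simp
  rw [Matrix.inv_eq_left_inv h, Matrix.of_apply]

include hG in
lemma ev_tr (T : Fin n → Fin n → SmoothFun (I ×ˢ U)) : ev ⟨(t, z), hz⟩ (S.tr T) =
    ∑ p, ∑ q, (G z)⁻¹ p q * ev ⟨(t, z), hz⟩ (T p q) := by
  simp only [FormalMetric.tr, map_sum, smul_eq_mul, map_mul, inv_apply_eq_ev S t G hG z hz]

include hU hd hG in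
lemma christoffel_eq_ev (i j k : Fin n) :
    christoffel G i j k z = ev ⟨(t, z), hz⟩ (S.chr i j k) := by
  have h (i j l : Fin n) : pd i (fun z => G z j l) z = ev ⟨(t, z), hz⟩ (S.d i (S.g j l)) :=
    pd_eq_ev_d hs hU S hd t z hz (fun z hz => (hG z hz j l).symm) i
  simp only [christoffel, FormalMetric.chr, map_smul, map_sum, map_mul, map_add, map_sub, h,
    inv_apply_eq_ev S t G hG z hz, smul_eq_mul]

lemma update_vecCons_zero {r : ℕ} (a m : Fin n) (f : Fin r → Fin n) :
    Function.update (Matrix.vecCons a f) 0 m = Matrix.vecCons m f :=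
  Fin.update_cons_zero _ _ _

lemma update_vecCons_succ {r : ℕ} (a m : Fin n) (f : Fin r → Fin n) (k : Fin r) :
    Function.update (Matrix.vecCons a f) k.succ m = Matrix.vecCons a (Function.update f k m) :=
  (Fin.cons_update _ _ _ _).symm

include hU hd in
-- In this family the hypothesis `hT` covers the whole time slice, not one point, because it is
-- differentiated. Rank 5 is needed for the Hessian of `Rm`.
lemma covD_eq_ev0 {T : Tensor n 0} {T' : SmoothFun (I ×ˢ U)}
    (hT : ∀ z, ∀ hz : (t, z) ∈ I ×ˢ U, T ![] z = ev ⟨(t, z), hz⟩ T') (i : Fin n) :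
    covD G T ![i] z = ev ⟨(t, z), hz⟩ (S.conn0.nab i T') := by
  change pd i (T ![]) z - _ = _
  rw [pd_eq_ev_d hs hU S hd t z hz hT]
  simp

include hU hd hG

lemma covD_eq_ev1 {T : Tensor n 1} {T' : Fin n → SmoothFun (I ×ˢ U)}
    (hT : ∀ z, ∀ hz : (t, z) ∈ I ×ˢ U, ∀ a, T ![a] z = ev ⟨(t, z), hz⟩ (T' a)) (i a : Fin n) :
    covD G T ![i, a] z = ev ⟨(t, z), hz⟩ (S.conn1.nab i T' a) := by
  change pd i (T ![a]) z - ∑ k, ∑ m, christoffel G i (![a] k) m z *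
    T (Function.update ![a] k m) z = _
  rw [pd_eq_ev_d hs hU S hd t z hz fun z hz => hT z hz a]
  simp only [Fin.sum_univ_succ, Finset.univ_eq_empty, Finset.sum_empty, update_vecCons_zero,
    update_vecCons_succ, Matrix.cons_val_zero, Matrix.cons_val_succ, hT z hz,
    christoffel_eq_ev hs hU S hd t G hG z hz]
  simp only [FormalMetric.Conn.ext_nab, FormalMetric.conn0_nab, map_sub, map_sum, smul_eq_mul,
    map_mul]
  ring

lemma covD_eq_ev2 {T : Tensor n 2} {T' : Fin n → Fin n → SmoothFun (I ×ˢ U)}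
    (hT : ∀ z, ∀ hz : (t, z) ∈ I ×ˢ U, ∀ a b, T ![a, b] z = ev ⟨(t, z), hz⟩ (T' a b))
    (i a b : Fin n) :
    covD G T ![i, a, b] z = ev ⟨(t, z), hz⟩ (S.conn2.nab i T' a b) := by
  change pd i (T ![a, b]) z - ∑ k, ∑ m, christoffel G i (![a, b] k) m z *
    T (Function.update ![a, b] k m) z = _
  rw [pd_eq_ev_d hs hU S hd t z hz fun z hz => hT z hz a b]
  simp only [Fin.sum_univ_succ, Finset.univ_eq_empty, Finset.sum_empty, update_vecCons_zero,
    update_vecCons_succ, Matrix.cons_val_zero, Matrix.cons_val_succ, hT z hz,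
    christoffel_eq_ev hs hU S hd t G hG z hz]
  simp only [FormalMetric.Conn.ext_nab, FormalMetric.conn0_nab, map_sub, map_sum, smul_eq_mul,
    map_mul, Pi.sub_apply, Finset.sum_apply, Pi.smul_apply]
  ring

lemma covD_eq_ev3 {T : Tensor n 3} {T' : Fin n → Fin n → Fin n → SmoothFun (I ×ˢ U)}
    (hT : ∀ z, ∀ hz : (t, z) ∈ I ×ˢ U, ∀ a b c, T ![a, b, c] z = ev ⟨(t, z), hz⟩ (T' a b c))
    (i a b c : Fin n) :
    covD G T ![i, a, b, c] z = ev ⟨(t, z), hz⟩ (S.conn3.nab i T' a b c) := by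
  change pd i (T ![a, b, c]) z - ∑ k, ∑ m, christoffel G i (![a, b, c] k) m z *
    T (Function.update ![a, b, c] k m) z = _
  rw [pd_eq_ev_d hs hU S hd t z hz fun z hz => hT z hz a b c]
  simp only [Fin.sum_univ_succ, Finset.univ_eq_empty, Finset.sum_empty, update_vecCons_zero,
    update_vecCons_succ, Matrix.cons_val_zero, Matrix.cons_val_succ, hT z hz,
    christoffel_eq_ev hs hU S hd t G hG z hz]
  simp only [FormalMetric.Conn.ext_nab, FormalMetric.conn0_nab, map_sub, map_sum, smul_eq_mul,
    map_mul, Pi.sub_apply, Finset.sum_apply, Pi.smul_apply]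
  ring

lemma covD_eq_ev4 {T : Tensor n 4} {T' : Fin n → Fin n → Fin n → Fin n → SmoothFun (I ×ˢ U)}
    (hT : ∀ z, ∀ hz : (t, z) ∈ I ×ˢ U, ∀ a b c e,
      T ![a, b, c, e] z = ev ⟨(t, z), hz⟩ (T' a b c e))
    (i a b c e : Fin n) :
    covD G T ![i, a, b, c, e] z = ev ⟨(t, z), hz⟩ (S.conn4.nab i T' a b c e) := by
  change pd i (T ![a, b, c, e]) z - ∑ k, ∑ m, christoffel G i (![a, b, c, e] k) m z *
    T (Function.update ![a, b, c, e] k m) z = _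
  rw [pd_eq_ev_d hs hU S hd t z hz fun z hz => hT z hz a b c e]
  simp only [Fin.sum_univ_succ, Finset.univ_eq_empty, Finset.sum_empty, update_vecCons_zero,
    update_vecCons_succ, Matrix.cons_val_zero, Matrix.cons_val_succ, hT z hz,
    christoffel_eq_ev hs hU S hd t G hG z hz]
  simp only [FormalMetric.Conn.ext_nab, FormalMetric.conn0_nab, map_sub, map_sum, smul_eq_mul,
    map_mul, Pi.sub_apply, Finset.sum_apply, Pi.smul_apply]
  ring

lemma covD_eq_ev5 {T : Tensor n 5}
    {T' : Fin n → Fin n → Fin n → Fin n → Fin n → SmoothFun (I ×ˢ U)}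
    (hT : ∀ z, ∀ hz : (t, z) ∈ I ×ˢ U, ∀ a b c e f,
      T ![a, b, c, e, f] z = ev ⟨(t, z), hz⟩ (T' a b c e f))
    (i a b c e f : Fin n) :
    covD G T ![i, a, b, c, e, f] z = ev ⟨(t, z), hz⟩ (S.conn5.nab i T' a b c e f) := by
  change pd i (T ![a, b, c, e, f]) z - ∑ k, ∑ m, christoffel G i (![a, b, c, e, f] k) m z *
    T (Function.update ![a, b, c, e, f] k m) z = _
  rw [pd_eq_ev_d hs hU S hd t z hz fun z hz => hT z hz a b c e f]
  simp only [Fin.sum_univ_succ, Finset.univ_eq_empty, Finset.sum_empty, update_vecCons_zero,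
    update_vecCons_succ, Matrix.cons_val_zero, Matrix.cons_val_succ, hT z hz,
    christoffel_eq_ev hs hU S hd t G hG z hz]
  simp only [FormalMetric.Conn.ext_nab, FormalMetric.conn0_nab, map_sub, map_sum, smul_eq_mul,
    map_mul, Pi.sub_apply, Finset.sum_apply, Pi.smul_apply]
  ring

lemma hess_eq_ev0 {T : Tensor n 0} {T' : SmoothFun (I ×ˢ U)}
    (hT : ∀ z, ∀ hz : (t, z) ∈ I ×ˢ U, T ![] z = ev ⟨(t, z), hz⟩ T') (i j : Fin n) :
    hess G T i j ![] z = ev ⟨(t, z), hz⟩ (S.conn0.hess i j T') :=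
  covD_eq_ev1 hs hU S hd t G hG z hz
    (fun z hz => covD_eq_ev0 hs hU S hd t G z hz hT) i j

lemma hess_eq_ev2 {T : Tensor n 2} {T' : Fin n → Fin n → SmoothFun (I ×ˢ U)}
    (hT : ∀ z, ∀ hz : (t, z) ∈ I ×ˢ U, ∀ a b, T ![a, b] z = ev ⟨(t, z), hz⟩ (T' a b))
    (i j a b : Fin n) :
    hess G T i j ![a, b] z = ev ⟨(t, z), hz⟩ (S.conn2.hess i j T' a b) :=
  covD_eq_ev3 hs hU S hd t G hG z hz
    (fun z hz => covD_eq_ev2 hs hU S hd t G hG z hz hT) i j a b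

lemma hess_eq_ev4 {T : Tensor n 4} {T' : Fin n → Fin n → Fin n → Fin n → SmoothFun (I ×ˢ U)}
    (hT : ∀ z, ∀ hz : (t, z) ∈ I ×ˢ U, ∀ a b c e,
      T ![a, b, c, e] z = ev ⟨(t, z), hz⟩ (T' a b c e))
    (i j a b c e : Fin n) :
    hess G T i j ![a, b, c, e] z = ev ⟨(t, z), hz⟩ (S.conn4.hess i j T' a b c e) :=
  covD_eq_ev5 hs hU S hd t G hG z hz
    (fun z hz => covD_eq_ev4 hs hU S hd t G hG z hz hT) i j a b c e

lemma laplacian_eq_ev0 {T : Tensor n 0} {T' : SmoothFun (I ×ˢ U)}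
    (hT : ∀ z, ∀ hz : (t, z) ∈ I ×ˢ U, T ![] z = ev ⟨(t, z), hz⟩ T') :
    laplacian G T ![] z = ev ⟨(t, z), hz⟩ (S.conn0.lap T') := by
  simp only [laplacian, FormalMetric.Conn.lap, ev_tr S t G hG z hz,
    hess_eq_ev0 hs hU S hd t G hG z hz hT]

lemma laplacian_eq_ev2 {T : Tensor n 2} {T' : Fin n → Fin n → SmoothFun (I ×ˢ U)}
    (hT : ∀ z, ∀ hz : (t, z) ∈ I ×ˢ U, ∀ a b, T ![a, b] z = ev ⟨(t, z), hz⟩ (T' a b))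
    (a b : Fin n) :
    laplacian G T ![a, b] z = ev ⟨(t, z), hz⟩ (S.conn2.lap T' a b) := by
  simp only [laplacian, FormalMetric.Conn.lap, FormalMetric.tr_apply,
    ev_tr S t G hG z hz, hess_eq_ev2 hs hU S hd t G hG z hz hT]

lemma laplacian_eq_ev4 {T : Tensor n 4}
    {T' : Fin n → Fin n → Fin n → Fin n → SmoothFun (I ×ˢ U)}
    (hT : ∀ z, ∀ hz : (t, z) ∈ I ×ˢ U, ∀ a b c e,
      T ![a, b, c, e] z = ev ⟨(t, z), hz⟩ (T' a b c e))
    (a b c e : Fin n) :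
    laplacian G T ![a, b, c, e] z = ev ⟨(t, z), hz⟩ (S.conn4.lap T' a b c e) := by
  simp only [laplacian, FormalMetric.Conn.lap, FormalMetric.tr_apply,
    ev_tr S t G hG z hz, hess_eq_ev4 hs hU S hd t G hG z hz hT]

lemma riem_eq_ev (i j k l : Fin n) :
    riem G ![i, j, k, l] z = ev ⟨(t, z), hz⟩ (S.rm i j k l) := by
  have h (i j k l : Fin n) : riem31 G i j k l z = ev ⟨(t, z), hz⟩ (S.rm31 i j k l) := by
    have h1 (i j k l : Fin n) : pd i (christoffel G j k l) z =
        ev ⟨(t, z), hz⟩ (S.d i (S.chr j k l)) :=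
      pd_eq_ev_d hs hU S hd t z hz
        (fun z hz => christoffel_eq_ev hs hU S hd t G hG z hz j k l) i
    simp only [riem31, FormalMetric.rm31, map_add, map_sub, map_sum, map_mul, h1,
      christoffel_eq_ev hs hU S hd t G hG z hz]
  change ∑ m, G z l m * riem31 G i j k m z = _
  simp only [FormalMetric.rm, map_sum, map_mul, h, hG]

lemma ric_eq_ev (i k : Fin n) : ric G ![i, k] z = ev ⟨(t, z), hz⟩ (S.rc i k) := by
  simp only [FormalMetric.rc, ev_tr S t G hG z hz,
    ← riem_eq_ev hs hU S hd t G hG z hz]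
  rfl

lemma scal_eq_ev (J : Fin 0 → Fin n) : scal G J z = ev ⟨(t, z), hz⟩ S.sc := by
  simp only [FormalMetric.sc, ev_tr S t G hG z hz, ← ric_eq_ev hs hU S hd t G hG z hz]
  rfl

lemma tensorB_eq_ev (i j k l : Fin n) :
    tensorB G i j k l z = ev ⟨(t, z), hz⟩ (S.tB i j k l) := by
  simp only [FormalMetric.tB, ev_tr S t G hG z hz, map_mul,
    ← riem_eq_ev hs hU S hd t G hG z hz, tensorB, Finset.mul_sum, mul_assoc]

lemma ricNormSq_eq_ev : ricNormSq G z =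
    ev ⟨(t, z), hz⟩ (S.tr fun i j => S.tr fun k l => S.rc i k * S.rc j l) := by
  simp only [ev_tr S t G hG z hz, map_mul,
    ← ric_eq_ev hs hU S hd t G hG z hz, ricNormSq, Finset.mul_sum, mul_assoc]

end Evaluation

/-! ### Nondegeneracy of the metric matrix in a chart -/

section Nondegenerate

variable {n : ℕ} {M : Type*} [TopologicalSpace M] [ChartedSpace (Coord n) M]
  [IsManifold (𝓡 n) ∞ M]

lemma metricCoord_symm (g : Metric (n := n) M) (e : OpenPartialHomeomorph M (Coord n))
    (y : Coord n) (i j : Fin n) : metricCoord g e y i j = metricCoord g e y j i :=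
  g.symm _ _ _

/-- A kernel vector `v` yields the tangent vector `∑ v_i ∂_i` of zero length. Positivity makes it
zero, and injectivity of the differential of the inverse chart gives `v = 0`. -/
lemma metricCoord_det_ne_zero (g : Metric (n := n) M) {e : OpenPartialHomeomorph M (Coord n)}
    (he : e ∈ IsManifold.maximalAtlas (𝓡 n) ∞ M) {y : Coord n} (hy : y ∈ e.target) :
    (metricCoord g e y).det ≠ 0 := by
  intro h0
  obtain ⟨v, hv, hv0⟩ := Matrix.exists_mulVec_eq_zero_iff.2 h0
  have hd : e.symm.MDifferentiable 𝓘(ℝ, Coord n) (𝓡 n) :=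
    ⟨(contMDiffOn_symm_of_mem_maximalAtlas he).mdifferentiableOn (by simp),
      (contMDiffOn_of_mem_maximalAtlas he).mdifferentiableOn (by simp)⟩
  have hinj := hd.mfderiv_injective (x := y) hy
  set L : Coord n →L[ℝ] TangentSpace (𝓡 n) (e.symm y) :=
    mfderiv 𝓘(ℝ, Coord n) (𝓡 n) e.symm y with hL
  set w : Coord n := ∑ i, v i • EuclideanSpace.single i (1 : ℝ) with hw
  have hLw : L w = ∑ i, v i • coordVec e i y := by
    rw [hw, map_sum]
    exact Finset.sum_congr rfl fun i _ => map_smul L _ _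
  have h1 : g.inner (e.symm y) (L w) (L w) = 0 := by
    rw [hLw]
    simp only [map_sum, map_smul, sum_apply, smul_apply,
      smul_eq_mul]
    refine Finset.sum_eq_zero fun i _ => mul_eq_zero_of_right _ ?_
    refine Eq.trans (Finset.sum_congr rfl fun j _ => ?_) (congrFun hv0 i)
    rw [g.symm, mul_comm]
    rfl
  have h3 : L w = 0 := by
    by_contra hne
    exact (g.pos _ _ hne).ne' h1
  have h4 : w = 0 := hinj (h3.trans (map_zero L).symm)
  refine hv (funext fun i => ?_)
  have h5 := congrArg (fun u : Coord n => u i) h4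
  simpa [hw, Pi.single_apply] using h5

end Nondegenerate

/-! ### The formal metric of a smooth family -/

section Formal

open SmoothFun

variable {n : ℕ} {I : Set ℝ} {U : Set (Coord n)}

/-- The formal metric given by a smooth family of nondegenerate symmetric matrices. -/
def FormalMetric.ofFamily (hs : UniqueDiffOn ℝ (I ×ˢ U))
    (hs' : I ×ˢ U ⊆ closure (interior (I ×ˢ U))) (G : ℝ → Coord n → Matrix (Fin n) (Fin n) ℝ)
    (hG : ∀ i j, ContDiffOn ℝ ∞ (fun p : ℝ × Coord n => G p.1 p.2 i j) (I ×ˢ U))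
    (hsymm : ∀ t y i j, G t y i j = G t y j i)
    (hdet : ∀ t, ∀ y ∈ U, (G t y).det ≠ 0) : FormalMetric n (SmoothFun (I ×ˢ U)) :=
  let m : Matrix (Fin n) (Fin n) (SmoothFun (I ×ˢ U)) := Matrix.of fun i j => ofContDiffOn (hG i j)
  have hm : m.transpose = m := by
    ext i j p
    exact hsymm _ _ _ _
  -- A nowhere vanishing determinant is invertible among smooth functions, so the inverse matrix has
  -- smooth entries jointly in time and space.
  have hu : IsUnit m.det := by
    refine isUnit_of_ne_zero _ fun p => ?_
    have h : ev p m.det = (G p.1.1 p.1.2).det := AlgHom.map_det (ev p) m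
    rw [h]
    exact hdet _ _ p.2.2
  { d := fun i => dirDeriv hs (0, EuclideanSpace.single i 1)
    g := m
    gu := (m⁻¹ : Matrix (Fin n) (Fin n) (SmoothFun (I ×ˢ U)))
    d_comm := fun i j a => dirDeriv_comm hs hs' _ _ a
    g_symm := fun i j => congrFun (congrFun hm j) i
    gu_symm := fun i j => by
      have h : m⁻¹.transpose = m⁻¹ := by rw [Matrix.transpose_nonsing_inv, hm]
      exact congrFun (congrFun h j) i
    gu_mul_g := fun i j => by
      have h := congrFun (congrFun (Matrix.nonsing_inv_mul m hu) i) j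
      rwa [Matrix.mul_apply, Matrix.one_apply] at h }

end Formal

end RBFlow

end

/-! ### The evolution equations on the manifold -/

open RBFlow in
theorem mainTheorem2 {n : ℕ} {M : Type*} [TopologicalSpace M]
    [ChartedSpace (RBFlow.Coord n) M] [IsManifold (𝓡 n) ∞ M]
    (ρ : ℝ) (I : Set ℝ) (hI : I.OrdConnected) (hI' : I.Nontrivial)
    (g : ℝ → RBFlow.Metric (n := n) M) (hg : RBFlow.IsRBFlow ρ I g)
    (e : OpenPartialHomeomorph M (RBFlow.Coord n))
    (he : e ∈ IsManifold.maximalAtlas (𝓡 n) ∞ M)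
    (t : ℝ) (ht : t ∈ I) (y : RBFlow.Coord n) (hy : y ∈ e.target) :
    let G : ℝ → RBFlow.Coord n → Matrix (Fin n) (Fin n) ℝ := fun s => RBFlow.metricCoord (g s) e
    let gl : Fin n → Fin n → ℝ := fun i j => G t y i j
    let gu : Fin n → Fin n → ℝ := fun i j => (G t y)⁻¹ i j
    let Rm : Fin n → Fin n → Fin n → Fin n → ℝ := fun i j k l => RBFlow.riem (G t) ![i, j, k, l] y
    let Rc : Fin n → Fin n → ℝ := fun i k => RBFlow.ric (G t) ![i, k] y
    let R : ℝ := RBFlow.scal (G t) ![] y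
    let B : Fin n → Fin n → Fin n → Fin n → ℝ := fun i j k l => RBFlow.tensorB (G t) i j k l y
    let hessR : Fin n → Fin n → ℝ := fun i j => RBFlow.hess (G t) (RBFlow.scal (G t)) i j ![] y
    let lapR : ℝ := RBFlow.laplacian (G t) (RBFlow.scal (G t)) ![] y
    (∀ i j k l : Fin n,
      HasDerivWithinAt (fun s => RBFlow.riem (G s) ![i, j, k, l] y)
        (RBFlow.laplacian (G t) (RBFlow.riem (G t)) ![i, j, k, l] y
          + 2 * (B i j k l - B i j l k - B i l j k + B i k j l)
          - ∑ p, ∑ q, gu p q *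
              (Rm p j k l * Rc q i + Rm i p k l * Rc q j + Rm i j p l * Rc q k
                + Rm i j k p * Rc q l)
          - ρ * (hessR i k * gl j l - hessR i l * gl j k - hessR j k * gl i l + hessR j l * gl i k)
          + 2 * ρ * R * Rm i j k l) I t) ∧
    (∀ i k : Fin n,
      HasDerivWithinAt (fun s => RBFlow.ric (G s) ![i, k] y)
        (RBFlow.laplacian (G t) (RBFlow.ric (G t)) ![i, k] y
          + 2 * ∑ p, ∑ q, ∑ r, ∑ s, gu p q * gu r s * Rm p i r k * Rc q s
          - 2 * ∑ p, ∑ q, gu p q * Rc p i * Rc q k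
          - ((n : ℝ) - 2) * ρ * hessR i k - ρ * lapR * gl i k) I t) ∧
    HasDerivWithinAt (fun s => RBFlow.scal (G s) ![] y)
      ((1 - 2 * ((n : ℝ) - 1) * ρ) * lapR + 2 * RBFlow.ricNormSq (G t) y - 2 * ρ * R ^ 2) I t := by
  intro G gl gu Rm Rc R B hessR lapR
  have hU : IsOpen e.target := e.open_target
  have hs := SmoothFun.uniqueDiffOn_cylinder hI hI' hU
  have hs' := SmoothFun.cylinder_subset_closure_interior hI hI' hU
  have hsymm (s : ℝ) (z : Coord n) (i j : Fin n) : G s z i j = G s z j i :=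
    metricCoord_symm (g s) e z i j
  set S := FormalMetric.ofFamily hs hs' G (hg.smooth e he) hsymm
    (fun s z hz => metricCoord_det_ne_zero (g s) he hz) with hS
  have hd (i : Fin n) : S.d i = SmoothFun.dirDeriv hs (0, EuclideanSpace.single i 1) := rfl
  have hG (s : ℝ) (z : Coord n) (hz : (s, z) ∈ I ×ˢ e.target) (i j : Fin n) :
      SmoothFun.ev ⟨(s, z), hz⟩ (S.g i j) = G s z i j := rfl
  clear_value S
  set D := SmoothFun.dirDeriv hs ((1, 0) : ℝ × Coord n) with hDdef
  have hD (i : Fin n) (a) : D (S.d i a) = S.d i (D a) := by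
    rw [hd]
    exact SmoothFun.dirDeriv_comm hs hs' _ _ a
  set c := algebraMap ℝ (SmoothFun (I ×ˢ e.target)) ρ with hcdef
  have hc (i : Fin n) : S.d i c = 0 := (S.d i).map_algebraMap ρ
  have hrm (s z hz) := riem_eq_ev hs hU S hd s (G s) (hG s) z hz
  have hrc (s z hz) := ric_eq_ev hs hU S hd s (G s) (hG s) z hz
  have hsc (s z hz) := scal_eq_ev hs hU S hd s (G s) (hG s) z hz
  -- The flow equation becomes an identity in the algebra: at each point both sides are derivatives
  -- within `I` of the same function, and such derivatives are unique, also at endpoints.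
  have hflow (i j : Fin n) : D (S.g i j) = -2 * (S.rc i j - c * (S.sc * S.g i j)) := by
    ext ⟨⟨s, z⟩, hz⟩
    have h1 := SmoothFun.hasDerivWithinAt_of_ev (S.g i j) hs s z hz
      (fun r hr => (hG r z hr i j).symm)
    have h2 : HasDerivWithinAt (fun r => G r z i j)
        (-2 * (ric (G s) ![i, j] z - ρ * scal (G s) ![] z * G s z i j)) I s :=
      hg.evolution e he s hz.1 z hz.2 i j
    have h3 := (uniqueDiffOn_convex hI.convex
      (SmoothFun.interior_nonempty_of_ordConnected hI hI') s hz.1).eq_deriv _ h1 h2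
    rw [hrc s z hz, hsc s z hz, ← hG s z hz, mul_assoc] at h3
    rw [← SmoothFun.ev_apply, ← SmoothFun.ev_apply, h3]
    simp only [map_mul, map_neg, map_sub, map_ofNat]
    rfl
  have hz : (t, y) ∈ I ×ˢ e.target := ⟨ht, hy⟩
  have ec : SmoothFun.ev ⟨(t, y), hz⟩ c = ρ := rfl
  have htr := ev_tr S t (G t) (hG t) y hz
  have hR : lapR = _ := laplacian_eq_ev0 hs hU S hd t (G t) (hG t) y hz
    (fun z hz => hsc t z hz ![])
  have hH (i j : Fin n) : hessR i j = _ := hess_eq_ev0 hs hU S hd t (G t) (hG t) y hz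
    (fun z hz => hsc t z hz ![]) i j
  refine ⟨fun i j k l => ?_, fun i k => ?_, ?_⟩
  · have h := SmoothFun.hasDerivWithinAt_of_ev (S.rm i j k l) hs t y hz
      (fun r hr => hrm r y hr i j k l)
    rw [← hDdef, S.derivation_rm D hD c hc hflow] at h
    convert h using 1
    simp only [map_add, map_sub, map_mul, map_ofNat, ec, htr, hH, gl, gu, Rm, Rc, R, B, hrm t y hz,
      hrc t y hz, hsc t y hz, ← hG t y hz, tensorB_eq_ev hs hU S hd t (G t) (hG t) y hz,
      laplacian_eq_ev4 hs hU S hd t (G t) (hG t) y hz (fun z hz => hrm t z hz)]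
  · have h := SmoothFun.hasDerivWithinAt_of_ev (S.rc i k) hs t y hz
      (fun r hr => hrc r y hr i k)
    rw [← hDdef, S.derivation_rc D hD c hc hflow] at h
    convert h using 1
    simp only [map_add, map_sub, map_mul, map_ofNat, map_natCast, ec, htr, hH, hR, gl, gu, Rm, Rc,
      hrm t y hz, hrc t y hz, ← hG t y hz, Finset.mul_sum, mul_assoc,
      laplacian_eq_ev2 hs hU S hd t (G t) (hG t) y hz (fun z hz => hrc t z hz)]
  · have h := SmoothFun.hasDerivWithinAt_of_ev S.sc hs t y hz
      (fun r hr => hsc r y hr ![])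
    rw [← hDdef, S.derivation_sc D hD c hc hflow] at h
    convert h using 1
    simp only [map_add, map_sub, map_mul, map_ofNat, map_natCast, map_one, map_pow, ec, hR, R,
      hsc t y hz, ricNormSq_eq_ev hs hU S hd t (G t) (hG t) y hz]
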